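/- Let $d\ge 0$, $T>0$, let $A$ and $Q$ be real symmetric $d\times d$ matrices with $A$ strictly negative definite and $Q$ strictly positive definite, and let $(W_t)_{t\ge0}$ be a $d$-dimensional Brownian motion on a probability space $(\Omega,\mathcal F,\mathbb P)$. Let $f\in C([0,T];\mathbb R^d)$, let $B_0:[0,T]\times\mathbb R^d\to\mathbb R^d$ be Borel measurable, and put $B(t,x)=B_0(t,x)-f(t)$. For $(s,x)\in[0,T]\times\mathbb R^d$ let $(Z^x_{s,t})_{t\in[s,T]}$ be the solution of $$\mathrm dZ^x_{s,t}=(AZ^x_{s,t}+f(t))\,\mathrm dt+\sqrt Q\,\mathrm dW_t,\qquad Z^x_{s,s}=x,$$ and for a function $\psi$ on $\mathbb R^d$ write $(S_{s,t}\psi)(x)=\mathbb E[\psi(Z^x_{s,t})]$. Set $$Q_t=\int_0^t e^{rA}Qe^{rA^*}\,\mathrm dr,\qquad \Lambda(t)=Q_t^{-1/2}e^{tA},\qquad F_{s,t}=\int_s^te^{(t-r)A}f(r)\,\mathrm dr .$$ Let $\phi:\mathbb R^d\to\mathbb R$ be bounded and measurable, and define $u^0_{s,t}=S_{s,t}\phi$,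 $$u^{n+1}_{s,t}(x)=(S_{s,t}\phi)(x)+\int_s^t\big(S_{s,r}\langle B(r,\cdot),Du^n_{r,t}\rangle\big)(x)\,\mathrm dr ,$$ $v^0=u^0$ and $v^{n+1}=u^{n+1}-u^{n}$ for $n\ge0$. Let $0\le s<t\le T$ and $x\in\mathbb R^d$ be such that $\int_s^t (t-r)^{-1/2}\,\mathbb E|B(r,Z^x_{s,r})|\,\mathrm dr<\infty$ (this holds, for instance, whenever $B$ is bounded). Then $v^0_{r,t}$ is differentiable on $\mathbb R^d$ for every $r\in[s,t)$; for almost every $r\in(s,t)$ the random variables $\langle B(r,Z^x_{s,r}),Dv^0_{r,t}(Z^x_{s,r})\rangle$ and $$\phi(Z^x_{s,t})\Big\langle\Lambda(t-r)B(r,Z^x_{s,r}),\,Q_{t-r}^{-1/2}\big(Z^x_{s,t}-e^{(t-r)A}Z^x_{s,r}-F_{r,t}\big)\Big\rangle$$ are integrable, and their expectations are integrable in $r$ over $(s,t)$; and $$v^1_{s,t}(x)=\int_s^t\mathbb E\Big[\phi(Z^x_{s,t})\Big\langle\Lambda(t-r)B(r,Z^x_{s,r}),\,Q_{t-r}^{-1/2}\big(Z^x_{s,t}-e^{(t-r)A}Z^x_{s,r}-F_{r,t}\big)\Big\rangle\Big]\,\mathrm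 dr .$$ -/

import Mathlib

open MeasureTheory ProbabilityTheory Set
open scoped NNReal ENNReal MatrixOrder RealInnerProductSpace Gradient

noncomputable section

namespace ShiftedKolmogorov

/-- The state space `ℝ^d` with its Euclidean structure. -/
abbrev Vec (d : ℕ) : Type := EuclideanSpace ℝ (Fin d)

/-- Real `d × d` matrices. -/
abbrev Mat (d : ℕ) : Type := Matrix (Fin d) (Fin d) ℝ

/-- The action of a matrix on a vector of `ℝ^d`. -/
abbrev act {d : ℕ} (M : Mat d) (v : Vec d) : Vec d := Matrix.toEuclideanCLM (𝕜 := ℝ) M v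

/-- `W` is a `d`-dimensional Brownian motion on `(Ω, P)`: its coordinates are independent
real Brownian motions. -/
structure IsBrownianMotion {d : ℕ} {Ω : Type*} [MeasurableSpace Ω]
    (W : ℝ≥0 → Ω → Vec d) (P : Measure Ω) : Prop where
  coord : ∀ i : Fin d, IsBrownianReal (fun t ω => W t ω i) P
  indep : iIndepFun (fun (i : Fin d) (ω : Ω) (t : ℝ≥0) => W t ω i) P

/-- `Y` solves `dY_t = (A Y_t + f(t)) dt + √Q dW_t` on `[s, T]` with `Y_s = x`. As `√Q` is constant,
`∫_s^t √Q dW = √Q (W_t - W_s)`, so that almost surely the path of `Y` is continuous and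
satisfies the integral equation at all times `t ∈ [s, T]`. (Such a `Y` is unique up to
indistinguishability, hence automatically adapted to the completed filtration of `W`.) -/
def IsLinearSDESolution {d : ℕ} {Ω : Type*} [MeasurableSpace Ω] (P : Measure Ω)
    (W : ℝ≥0 → Ω → Vec d) (A Q : Mat d) (f : ℝ → Vec d) (T s : ℝ) (x : Vec d)
    (Y : ℝ → Ω → Vec d) : Prop :=
  ∀ᵐ ω ∂P, ContinuousOn (fun t => Y t ω) (Icc s T) ∧
    ∀ t ∈ Icc s T, Y t ω = x + (∫ r in s..t, (act A (Y r ω) + f r))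
      + act (CFC.sqrt Q) (W t.toNNReal ω - W s.toNNReal ω)

/-- The matrix exponential `e^{tA}`. -/
def expMat {d : ℕ} (A : Mat d) (t : ℝ) : Mat d := NormedSpace.exp (t • A)

/-- `Q_t = ∫_0^t e^{rA} Q e^{rA^*} dr`, integrated entry by entry. -/
def covMat {d : ℕ} (A Q : Mat d) (t : ℝ) : Mat d :=
  Matrix.of fun i j => ∫ r in (0 : ℝ)..t, (expMat A r * Q * expMat A.transpose r) i j

/-- `Q_t^{-1/2}`, the inverse of the positive square root of `Q_t`. -/
def invSqrtCov {d : ℕ} (A Q : Mat d) (t : ℝ) : Mat d := (CFC.sqrt (covMat A Q t))⁻¹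

/-- `Λ(t) = Q_t^{-1/2} e^{tA}`. -/
def Lam {d : ℕ} (A Q : Mat d) (t : ℝ) : Mat d := invSqrtCov A Q t * expMat A t

/-- `F_{s,t} = ∫_s^t e^{(t-r)A} f(r) dr`. -/
def shiftInt {d : ℕ} (A : Mat d) (f : ℝ → Vec d) (s t : ℝ) : Vec d :=
  ∫ r in s..t, act (expMat A (t - r)) (f r)

/-- The evolution operator `(S_{s,t} φ)(x) = E[φ(Z_{s,t}^x)]`; here `Z s x t` is the random
variable `Z_{s,t}^x`. -/
def evol {d : ℕ} {Ω : Type*} [MeasurableSpace Ω] (P : Measure Ω)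
    (Z : ℝ → Vec d → ℝ → Ω → Vec d) (s t : ℝ) (φ : Vec d → ℝ) (x : Vec d) : ℝ :=
  ∫ ω, φ (Z s x t ω) ∂P

/-- The iteration scheme: `u^0_{s,t} = S_{s,t} φ` and
`u^{n+1}_{s,t}(x) = S_{s,t} φ(x) + ∫_s^t (S_{s,r} ⟨B(r,·), D u^n_{r,t}⟩)(x) dr`. -/
def iter {d : ℕ} {Ω : Type*} [MeasurableSpace Ω] (P : Measure Ω)
    (Z : ℝ → Vec d → ℝ → Ω → Vec d) (B : ℝ → Vec d → Vec d) (φ : Vec d → ℝ) :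
    ℕ → ℝ → ℝ → Vec d → ℝ
  | 0, s, t, x => evol P Z s t φ x
  | n + 1, s, t, x => evol P Z s t φ x
      + ∫ r in s..t, evol P Z s r (fun y => ⟪B r y, ∇ (iter P Z B φ n r t) y⟫) x

/-- The increments `v^0 = u^0` and `v^{n+1} = u^{n+1} - u^n`. -/
def incr {d : ℕ} {Ω : Type*} [MeasurableSpace Ω] (P : Measure Ω)
    (Z : ℝ → Vec d → ℝ → Ω → Vec d) (B : ℝ → Vec d → Vec d) (φ : Vec d → ℝ) :
    ℕ → ℝ → ℝ → Vec d → ℝ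
  | 0, s, t, x => iter P Z B φ 0 s t x
  | n + 1, s, t, x => iter P Z B φ (n + 1) s t x - iter P Z B φ n s t x

/-- The random variable
`φ(Z_{s,t}^x) ⟨Λ(t-r) B(r, Z_{s,r}^x), Q_{t-r}^{-1/2} (Z_{s,t}^x - e^{(t-r)A} Z_{s,r}^x - F_{r,t})⟩`. -/
def weighted {d : ℕ} {Ω : Type*} (A Q : Mat d) (f : ℝ → Vec d)
    (Z : ℝ → Vec d → ℝ → Ω → Vec d) (B : ℝ → Vec d → Vec d) (φ : Vec d → ℝ)
    (s t : ℝ) (x : Vec d) (r : ℝ) (ω : Ω) : ℝ :=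
  φ (Z s x t ω) *
    ⟪act (Lam A Q (t - r)) (B r (Z s x r ω)),
      act (invSqrtCov A Q (t - r))
        (Z s x t ω - act (expMat A (t - r)) (Z s x r ω) - shiftInt A f r t)⟫

end ShiftedKolmogorov

end

noncomputable section

/-! The formula is a Bismut–Elworthy–Li identity. By variation of constants, `Z_{s,t}` equals
`e^{(t-r)A} Z_{s,r} + F_{r,t} + N_{r,t}`, where the noise `N_{r,t}` after time `r` is centered
Gaussian with covariance `Q_{t-r}` and independent of `Z_{s,r}` (`ae_solution_flow`,
`map_solution_noise`). Hence `u^0_{r,t}(y)` is the mean of `φ(e^{(t-r)A} y + F_{r,t} + Q_{t-r}^{1/2}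
ζ)` for a standard Gaussian `ζ`. Since `Q_{t-r}^{1/2}` is invertible, moving `y` by `h` amounts to
shifting `ζ` by `Λ(t-r) h`. The Cameron–Martin formula puts that shift on the density, so no
regularity of `φ` is needed, and `⟨B, Du^0⟩` becomes the mean of `φ(...) ⟨Λ(t-r) B, ζ⟩`
(`inner_gradient_integral_affine_stdGaussian`).

Evaluating at `y = Z_{s,r}` and averaging, independence and Fubini replace `ζ` by `Q_{t-r}^{-1/2}
N_{r,t}`, which is the weight in the formula. The same terms `S_{s,t} φ` in `u^1` and `u^0` cancel,
so integrating over `r` gives `v^1`. Integrability in `r` rests on the bound `‖Λ(τ)‖ ≤ C τ^{-1/2}`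
(`exists_norm_act_Lam_le`), which matches the moment condition on `B`.

No stochastic integral is used: `noise` is defined path by path through integration by parts, and
its law is found from characteristic functions of Riemann sums (`map_noise_prodMk`). -/

namespace ShiftedKolmogorov

open Filter Topology

/-! ### Riemann–Stieltjes sums and variation of constants along continuous paths. -/

section Deterministic

variable {E F : Type*} [NormedAddCommGroup E] [NormedSpace ℝ E]
  [NormedAddCommGroup F] [NormedSpace ℝ F]

/-- The `k`-th point of the partition of `[s, t]` into `n` intervals of equal length. -/
def node (s t : ℝ) (n k : ℕ) : ℝ := s + k * ((t - s) / n)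

@[simp] lemma node_zero (s t : ℝ) (n : ℕ) : node s t n 0 = s := by simp [node]

lemma node_self (s t : ℝ) {n : ℕ} (hn : n ≠ 0) : node s t n n = t := by
  have : (n : ℝ) ≠ 0 := by exact_mod_cast hn
  unfold node; field_simp; ring

lemma node_succ_sub (s t : ℝ) (n k : ℕ) : node s t n (k + 1) - node s t n k = (t - s) / n := by
  unfold node; push_cast; ring

lemma monotone_node {s t : ℝ} (hst : s ≤ t) (n : ℕ) : Monotone (node s t n) := by
  refine monotone_nat_of_le_succ fun k => ?_
  have : 0 ≤ (t - s) / n := div_nonneg (by linarith) (by positivity)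
  linarith [node_succ_sub s t n k]

lemma node_mem_Icc {s t : ℝ} (hst : s ≤ t) {n k : ℕ} (hn : n ≠ 0) (hk : k ≤ n) :
    node s t n k ∈ Icc s t :=
  ⟨by simpa using monotone_node hst n (Nat.zero_le k),
    by simpa [node_self s t hn] using monotone_node hst n hk⟩

/-- On each cell `K` is integrated exactly and only `w` is frozen at a tag, so the error is at most
`sup ‖K‖` times the oscillation of `w` times the length. Free tags serve both ordinary Riemann sums
and the remainder of a summation by parts. -/
lemma tendsto_tagged_sum [CompleteSpace F] {s t : ℝ} (hst : s ≤ t) {K : ℝ → E →L[ℝ] F}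
    (hK : Continuous K)
    {w : ℝ → E} (hw : ContinuousOn w (Icc s t)) (p : ℕ → ℕ → ℝ)
    (hp : ∀ n k, p n k ∈ Icc (node s t n k) (node s t n (k + 1))) :
    Tendsto (fun n : ℕ => ∑ k ∈ Finset.range n,
      ∫ u in (node s t n k)..(node s t n (k + 1)), K u (w (p n k))) atTop
      (𝓝 (∫ u in s..t, K u (w u))) := by
  obtain ⟨C, hC⟩ := (isCompact_Icc (a := s) (b := t)).exists_bound_of_continuousOn hK.continuousOn
  have hC0 : 0 ≤ C := (norm_nonneg _).trans (hC s ⟨le_rfl, hst⟩)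
  have huc := (isCompact_Icc (a := s) (b := t)).uniformContinuousOn_of_continuous hw
  rw [Metric.tendsto_atTop]
  intro ε hε
  -- This makes the total error `C * η * (t - s)` less than `ε`; the added ones keep the denominator
  -- positive when `C = 0` or `s = t`.
  set η := ε / (2 * (C + 1) * (t - s + 1)) with hη
  have hD : 0 < 2 * (C + 1) * (t - s + 1) := by
    have : 0 < t - s + 1 := by linarith
    positivity
  have hη0 : 0 < η := div_pos hε hD
  obtain ⟨δ, hδ, hwδ⟩ := Metric.uniformContinuousOn_iff.1 huc η hη0
  obtain ⟨n₀, hn₀⟩ := exists_nat_gt ((t - s) / δ)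
  refine ⟨n₀ + 1, fun n hn => ?_⟩
  have hn0 : n ≠ 0 := by omega
  have hnpos : (0 : ℝ) < n := by positivity
  have hmesh : (t - s) / n < δ := by
    have : (n₀ : ℝ) ≤ n := by exact_mod_cast (by omega : n₀ ≤ n)
    rw [div_lt_iff₀ hδ] at hn₀
    rw [div_lt_iff₀ hnpos]
    nlinarith
  have hmono := monotone_node hst n
  have hKw : ContinuousOn (fun u => K u (w u)) (Icc s t) := hK.continuousOn.clm_apply hw
  have hsub : ∀ k < n, Icc (node s t n k) (node s t n (k + 1)) ⊆ Icc s t := fun k hk =>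
    Icc_subset_Icc (node_mem_Icc hst hn0 hk.le).1 (node_mem_Icc hst hn0 hk).2
  have hii : ∀ k < n, IntervalIntegrable (fun u => K u (w u)) volume
      (node s t n k) (node s t n (k + 1)) := fun k hk =>
    (hKw.mono (hsub k hk)).intervalIntegrable_of_Icc (hmono k.le_succ)
  have hsplit : ∫ u in s..t, K u (w u) = ∑ k ∈ Finset.range n,
      ∫ u in (node s t n k)..(node s t n (k + 1)), K u (w u) := by
    rw [intervalIntegral.sum_integral_adjacent_intervals hii, node_zero, node_self s t hn0]
  rw [hsplit, dist_eq_norm, ← Finset.sum_sub_distrib]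
  have hterm : ∀ k ∈ Finset.range n,
      ‖(∫ u in (node s t n k)..(node s t n (k + 1)), K u (w (p n k))) -
        ∫ u in (node s t n k)..(node s t n (k + 1)), K u (w u)‖ ≤ C * η * ((t - s) / n) := by
    intro k hk
    rw [Finset.mem_range] at hk
    have hle := hmono k.le_succ
    rw [← intervalIntegral.integral_sub
      ((hK.clm_apply continuous_const).intervalIntegrable _ _) (hii k hk)]
    rw [← node_succ_sub s t n k, ← abs_of_nonneg (sub_nonneg.2 hle)]
    refine intervalIntegral.norm_integral_le_of_norm_le_const fun u hu => ?_
    rw [uIoc_of_le hle] at hu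
    have hu' : u ∈ Icc (node s t n k) (node s t n (k + 1)) := Ioc_subset_Icc_self hu
    rw [← map_sub]
    refine (ContinuousLinearMap.le_opNorm _ _).trans ?_
    refine mul_le_mul (hC u (hsub k hk hu')) ?_ (norm_nonneg _) hC0
    rw [← dist_eq_norm]
    refine (hwδ _ (hsub k hk (hp n k)) _ (hsub k hk hu') ?_).le
    rw [Real.dist_eq]
    refine lt_of_le_of_lt ?_ hmesh
    rw [← node_succ_sub s t n k, abs_le]
    have := hp n k
    constructor <;> linarith [this.1, this.2, hu'.1, hu'.2]
  refine lt_of_le_of_lt ((norm_sum_le _ _).trans (Finset.sum_le_sum hterm)) ?_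
  rw [Finset.sum_const, Finset.card_range, nsmul_eq_mul]
  have : (n : ℝ) * (C * η * ((t - s) / n)) = C * η * (t - s) := by field_simp
  rw [this]
  have h1 : η * (2 * (C + 1) * (t - s + 1)) = ε := div_mul_cancel₀ _ hD.ne'
  have h2 : 0 ≤ t - s := by linarith
  nlinarith [mul_nonneg hC0 h2, mul_nonneg hη0.le (mul_nonneg hC0 h2), mul_nonneg hη0.le hC0,
    mul_nonneg hη0.le h2]

lemma tendsto_riemann_sum {s t : ℝ} (hst : s ≤ t)
    {h : ℝ → ℝ} (hh : ContinuousOn h (Icc s t)) :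
    Tendsto (fun n : ℕ => ∑ k ∈ Finset.range n,
      h (node s t n k) * (node s t n (k + 1) - node s t n k)) atTop
      (𝓝 (∫ u in s..t, h u)) := by
  have := tendsto_tagged_sum hst (K := fun _ => ContinuousLinearMap.id ℝ ℝ) continuous_const hh
    (fun n k => node s t n k) (fun n k => ⟨le_rfl, monotone_node hst n k.le_succ⟩)
  simpa [mul_comm] using this

/-- Integration by parts gives a meaning to `∫ H dw` for `w` merely continuous: all differentiation
falls on `H`. -/
lemma tendsto_riemannStieltjes_sum [CompleteSpace E] [CompleteSpace F] {s t : ℝ} (hst : s ≤ t)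
    {H H' : ℝ → E →L[ℝ] F} (hH : ∀ u, HasDerivAt H (H' u) u) (hH' : Continuous H')
    {w : ℝ → E} (hw : ContinuousOn w (Icc s t)) :
    Tendsto (fun n : ℕ => ∑ k ∈ Finset.range n,
      H (node s t n k) (w (node s t n (k + 1)) - w (node s t n k))) atTop
      (𝓝 (H t (w t) - H s (w s) - ∫ u in s..t, H' u (w u))) := by
  -- The tag is the right endpoint because `H_k (w_{k+1} - w_k) = (H_{k+1} w_{k+1} - H_k w_k) -
  -- (H_{k+1} - H_k) w_{k+1}` holds exactly.
  have h1 := (tendsto_tagged_sum hst hH' hw (fun n k => node s t n (k + 1))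
    (fun n k => ⟨monotone_node hst n k.le_succ, le_rfl⟩)).const_sub (H t (w t) - H s (w s))
  refine h1.congr' ?_
  filter_upwards [eventually_ne_atTop 0] with n hn
  have hint : ∀ k, ∫ u in (node s t n k)..(node s t n (k + 1)), H' u (w (node s t n (k + 1))) =
      H (node s t n (k + 1)) (w (node s t n (k + 1))) - H (node s t n k) (w (node s t n (k + 1))) := by
    intro k
    rw [← ContinuousLinearMap.intervalIntegral_apply (hH'.intervalIntegrable _ _),
      intervalIntegral.integral_eq_sub_of_hasDerivAt (fun u _ => hH u) (hH'.intervalIntegrable _ _)]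
    rfl
  have htel : H t (w t) - H s (w s) = ∑ k ∈ Finset.range n,
      (H (node s t n (k + 1)) (w (node s t n (k + 1))) - H (node s t n k) (w (node s t n k))) := by
    rw [Finset.sum_range_sub (fun k => H (node s t n k) (w (node s t n k))), node_zero,
      node_self s t hn]
  rw [htel, ← Finset.sum_sub_distrib]
  refine Finset.sum_congr rfl fun k _ => ?_
  rw [hint, map_sub]
  abel

lemma hasDerivAt_exp_sub_smul [CompleteSpace E] (a : E →L[ℝ] E) (t u : ℝ) :
    HasDerivAt (fun u : ℝ => NormedSpace.exp ((t - u) • a))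
      (-(NormedSpace.exp ((t - u) • a) * a)) u := by
  have := (hasDerivAt_exp_smul_const (𝕂 := ℝ) a (t - u)).scomp u
    ((hasDerivAt_id u).const_sub t)
  simpa [Function.comp_def] using this

lemma continuous_exp_sub_smul [CompleteSpace E] (a : E →L[ℝ] E) (t : ℝ) :
    Continuous (fun u : ℝ => NormedSpace.exp ((t - u) • a)) :=
  continuous_iff_continuousAt.2 fun u => (hasDerivAt_exp_sub_smul a t u).continuousAt

lemma tendsto_convolution_sum [CompleteSpace E] (a σ : E →L[ℝ] E) {s t : ℝ} (hst : s ≤ t)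
    {w : ℝ → E} (hw : ContinuousOn w (Icc s t)) (hws : w s = 0) :
    Tendsto (fun n : ℕ => ∑ k ∈ Finset.range n, NormedSpace.exp ((t - node s t n k) • a)
      (σ (w (node s t n (k + 1)) - w (node s t n k)))) atTop
      (𝓝 (σ (w t) + ∫ u in s..t, NormedSpace.exp ((t - u) • a) (a (σ (w u))))) := by
  have hH : ∀ u : ℝ, HasDerivAt (fun u => NormedSpace.exp ((t - u) • a) * σ)
      (-(NormedSpace.exp ((t - u) • a) * a) * σ) u :=
    fun u => (hasDerivAt_exp_sub_smul a t u).mul_const _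
  have h := tendsto_riemannStieltjes_sum hst hH
    ((((continuous_exp_sub_smul a t).mul continuous_const).neg).mul continuous_const) hw
  simpa [hws] using h

/-- Variation of constants for a linear integral equation with additive forcing `g`. -/
lemma variation_of_constants [CompleteSpace E] (a : E →L[ℝ] E) {s t : ℝ} (hst : s ≤ t)
    {y f g : ℝ → E} {x : E} (hy : ContinuousOn y (Icc s t)) (hf : ContinuousOn f (Icc s t))
    (hg : ContinuousOn g (Icc s t))
    (heq : ∀ u ∈ Icc s t, y u = x + (∫ r in s..u, (a (y r) + f r)) + g u) :
    y t = NormedSpace.exp ((t - s) • a) x + (∫ r in s..t, NormedSpace.exp ((t - r) • a) (f r)) +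
      (g t + ∫ r in s..t, NormedSpace.exp ((t - r) • a) (a (g r))) := by
  set U : ℝ → E →L[ℝ] E := fun u => NormedSpace.exp ((t - u) • a) with hU
  have hUc : Continuous U := continuous_exp_sub_smul a t
  -- The path `y` need not be differentiable, since `g` is only continuous. Its part `M = y - g` is,
  -- and the derivative of `U M` is `U (a y + f) - U a M = U f + U a g`.
  set M : ℝ → E := fun u => x + ∫ r in s..u, (a (y r) + f r) with hM
  have hk : ContinuousOn (fun r => a (y r) + f r) (Icc s t) :=
    (a.continuous.comp_continuousOn hy).add hf
  have hki : IntervalIntegrable (fun r => a (y r) + f r) volume s t :=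
    hk.intervalIntegrable_of_Icc hst
  have hMc : ContinuousOn M (Icc s t) := by
    refine continuousOn_const.add ?_
    have := intervalIntegral.continuousOn_primitive_interval (μ := volume) (a := s) (b := t)
      (f := fun r => a (y r) + f r) (by rw [uIcc_of_le hst]; exact hk.integrableOn_Icc)
    rwa [uIcc_of_le hst] at this
  have hMy : ∀ u ∈ Icc s t, y u = M u + g u := fun u hu => heq u hu
  have hMd : ∀ u ∈ Ioo s t, HasDerivAt M (a (y u) + f u) u := by
    intro u hu
    have hcu : ContinuousAt (fun r => a (y r) + f r) u := hk.continuousAt (Icc_mem_nhds hu.1 hu.2)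
    refine HasDerivAt.const_add x ?_
    refine intervalIntegral.integral_hasDerivAt_right
      (hki.mono_set (by rw [uIcc_of_le hst, uIcc_of_le hu.1.le]; exact Icc_subset_Icc_right hu.2.le))
      ?_ hcu
    exact (hk.mono Ioo_subset_Icc_self).stronglyMeasurableAtFilter isOpen_Ioo u hu
  have hfi : IntervalIntegrable (fun r => U r (f r)) volume s t :=
    (hUc.continuousOn.clm_apply hf).intervalIntegrable_of_Icc hst
  have hgi : IntervalIntegrable (fun r => U r (a (g r))) volume s t :=
    (hUc.continuousOn.clm_apply (a.continuous.comp_continuousOn hg)).intervalIntegrable_of_Icc hst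
  have hftc := intervalIntegral.integral_eq_sub_of_hasDerivAt_of_le hst
    (f := fun u => U u (M u)) (f' := fun u => U u (f u) + U u (a (g u)))
    (hUc.continuousOn.clm_apply hMc) (fun u hu => by
      have h := (hasDerivAt_exp_sub_smul a t u).clm_apply (hMd u hu)
      convert h using 1
      rw [hMy u (Ioo_subset_Icc_self hu)]
      simp only [hU, map_add, neg_apply, mul_apply_eq_comp]
      abel) (hfi.add hgi)
  rw [intervalIntegral.integral_add hfi hgi] at hftc
  have hUt : U t = 1 := by simp [hU]
  have hMs : M s = x := by simp [hM]
  simp only [hUt, hMs] at hftc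
  rw [hMy t ⟨hst, le_rfl⟩]
  simp only [one_apply_eq_self] at hftc
  rw [show M t = (M t - U s x) + U s x by abel, ← hftc]
  abel

end Deterministic

/-! ### Characteristic functions of linear combinations of Brownian increments. -/

section BrownianIncrements

variable {Ω : Type*} [MeasurableSpace Ω] {P : Measure Ω}

lemma integral_cexp_sum_increments {X : ℝ≥0 → Ω → ℝ} (hX : IsPreBrownianReal X P)
    {τ : ℕ → ℝ≥0} (hτ : Monotone τ) (c : ℕ → ℝ) (n : ℕ) :
    ∫ ω, Complex.exp ((∑ k ∈ Finset.range n, c k * (X (τ (k + 1)) ω - X (τ k) ω) : ℝ) *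
        Complex.I) ∂P =
      Complex.exp (-(∑ k ∈ Finset.range n, c k ^ 2 * ((τ (k + 1) : ℝ) - τ k) : ℝ) / 2) := by
  have hind := hX.hasIndepIncrements n (fun k : Fin (n + 1) => τ k)
    (fun i j hij => hτ (by exact_mod_cast hij))
  have hmeas : ∀ k : Fin n, AEMeasurable
      (fun ω => X (τ k.succ) ω - X (τ k.castSucc) ω) P := fun k =>
    (hX.aemeasurable _).sub (hX.aemeasurable _)
  have hprod := hind.integral_fun_prod_comp
    (f := fun (k : Fin n) (x : ℝ) => Complex.exp ((c k * x : ℝ) * Complex.I)) hmeas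
    (fun k => (Measurable.aestronglyMeasurable (by fun_prop)))
  have hfac : ∀ k : Fin n,
      ∫ ω, Complex.exp ((c k * (X (τ k.succ) ω - X (τ k.castSucc) ω) : ℝ) * Complex.I) ∂P =
        Complex.exp (-(c k ^ 2 * ((τ (k + 1) : ℝ) - τ k) : ℝ) / 2) := by
    intro k
    have hlaw := hX.hasLaw_sub (τ k.succ) (τ k.castSucc)
    have h1 := charFun_gaussianReal (μ := 0)
      (v := nndist (τ k.succ).1 (τ k.castSucc).1) (c k)
    rw [← hlaw.map_eq, charFun_apply_real, integral_map hlaw.aemeasurable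
      (Measurable.aestronglyMeasurable (by fun_prop))] at h1
    have hle : (τ k : ℝ) ≤ τ (k + 1) := by exact_mod_cast hτ (Nat.le_succ k)
    -- The variance of an increment comes as a distance of times; monotonicity of `τ` turns it into
    -- a difference.
    have hd : ((nndist (τ k.succ).1 (τ k.castSucc).1 : ℝ≥0) : ℝ) =
        (τ (k + 1) : ℝ) - τ k := by
      simp only [Fin.val_succ, Fin.val_castSucc, coe_nndist, Real.dist_eq]
      exact abs_of_nonneg (sub_nonneg.2 hle)
    convert h1 using 2
    · ext ω; simp
    · rw [← Complex.ofReal_pow, show ∀ v : ℝ≥0, ((v : ℝ≥0) : ℂ) = ((v : ℝ) : ℂ) from fun _ => rfl, hd]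
      push_cast
      ring
  calc _ = ∫ ω, ∏ k : Fin n,
        Complex.exp ((c k * (X (τ k.succ) ω - X (τ k.castSucc) ω) : ℝ) * Complex.I) ∂P := by
        congr 1; ext ω
        rw [← Complex.exp_sum, Finset.sum_range]
        push_cast
        rw [Finset.sum_mul]
        rfl
    _ = _ := by
        rw [hprod, Finset.prod_congr rfl (fun k _ => hfac k), ← Complex.exp_sum,
          Finset.sum_range]
        push_cast
        rw [← Finset.sum_div, Finset.sum_neg_distrib]

lemma IsBrownianMotion.aemeasurable {d : ℕ} {W : ℝ≥0 → Ω → Vec d} (hW : IsBrownianMotion W P)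
    (t : ℝ≥0) : AEMeasurable (W t) P := by
  have h : AEMeasurable (fun ω i => W t ω i) P :=
    aemeasurable_pi_lambda _ fun i => (hW.coord i).aemeasurable t
  exact (MeasurableEquiv.toLp 2 (Fin d → ℝ)).measurable.comp_aemeasurable h

lemma IsBrownianMotion.continuous {d : ℕ} {W : ℝ≥0 → Ω → Vec d} (hW : IsBrownianMotion W P) :
    ∀ᵐ ω ∂P, Continuous (fun t => W t ω) := by
  filter_upwards [ae_all_iff.2 fun i => (hW.coord i).cont] with ω hω
  exact (PiLp.continuous_toLp 2 _).comp (continuous_pi hω)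

/-- Independence of the coordinates factors the expectation over `i`; the scalar case handles each
factor, and exchanging the sums over `i` and `k` assembles `‖c k‖ ^ 2`. -/
lemma IsBrownianMotion.integral_cexp_sum_increments {d : ℕ} [IsProbabilityMeasure P]
    {W : ℝ≥0 → Ω → Vec d} (hW : IsBrownianMotion W P)
    {τ : ℕ → ℝ≥0} (hτ : Monotone τ) (c : ℕ → Vec d) (n : ℕ) :
    ∫ ω, Complex.exp ((∑ k ∈ Finset.range n, ⟪c k, W (τ (k + 1)) ω - W (τ k) ω⟫ : ℝ) *
        Complex.I) ∂P =
      Complex.exp (-(∑ k ∈ Finset.range n, ‖c k‖ ^ 2 * ((τ (k + 1) : ℝ) - τ k) : ℝ) / 2) := by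
  have hind : iIndepFun (fun (i : Fin d) (ω : Ω) =>
      ∑ k ∈ Finset.range n, c k i * (W (τ (k + 1)) ω i - W (τ k) ω i)) P :=
    hW.indep.comp (fun i (w : ℝ≥0 → ℝ) =>
      ∑ k ∈ Finset.range n, c k i * (w (τ (k + 1)) - w (τ k))) (fun i => by fun_prop)
  have hmeas : ∀ i : Fin d, AEMeasurable (fun ω =>
      ∑ k ∈ Finset.range n, c k i * (W (τ (k + 1)) ω i - W (τ k) ω i)) P := fun i =>
    Finset.aemeasurable_fun_sum _ fun k _ =>
      (((hW.coord i).aemeasurable _).sub ((hW.coord i).aemeasurable _)).const_mul _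
  have hprod := hind.integral_fun_prod_comp
    (f := fun (_ : Fin d) (x : ℝ) => Complex.exp ((x : ℂ) * Complex.I)) hmeas
    (fun k => (Measurable.aestronglyMeasurable (by fun_prop)))
  rw [Finset.prod_congr rfl (fun i _ => ShiftedKolmogorov.integral_cexp_sum_increments
    (hW.coord i).toIsPreBrownianReal hτ (fun k => c k i) n), ← Complex.exp_sum] at hprod
  refine Eq.trans (integral_congr_ae (ae_of_all _ fun ω => ?_)) (hprod.trans ?_)
  · simp only
    rw [← Complex.exp_sum, ← Finset.sum_mul, ← Complex.ofReal_sum]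
    congr 3
    rw [Finset.sum_comm]
    refine Finset.sum_congr rfl fun k _ => ?_
    simp [PiLp.inner_apply, mul_comm]
  · congr 1
    rw [← Finset.sum_div]
    congr 1
    rw [Finset.sum_neg_distrib, ← Complex.ofReal_sum]
    congr 2
    rw [Finset.sum_comm]
    refine Finset.sum_congr rfl fun k _ => ?_
    rw [EuclideanSpace.real_norm_sq_eq, Finset.sum_mul]

end BrownianIncrements

/-! ### The covariance `Q_t`: positivity, behaviour near zero, continuity in time. -/

section MatrixFacts

variable {d : ℕ}

/-- The operator on `ℝ^d` attached to a matrix. -/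
abbrev op (M : Mat d) : Vec d →L[ℝ] Vec d := Matrix.toEuclideanCLM (𝕜 := ℝ) M

open scoped Matrix.Norms.L2Operator in
lemma continuous_op : Continuous (op : Mat d → Vec d →L[ℝ] Vec d) :=
  LinearMap.continuous_of_finiteDimensional
    ((Matrix.toEuclideanCLM (𝕜 := ℝ) (n := Fin d)).toAlgEquiv.toLinearMap)

open scoped Matrix.Norms.L2Operator in
lemma continuous_expMat (A : Mat d) : Continuous (expMat A) := by
  let _ : NormedAlgebra ℚ (Mat d) := .restrictScalars ℚ ℝ (Mat d)
  exact NormedSpace.exp_continuous.comp (continuous_id.smul continuous_const)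

open scoped Matrix.Norms.L2Operator in
lemma op_expMat (A : Mat d) (t : ℝ) : op (expMat A t) = NormedSpace.exp (t • op A) := by
  let _ : NormedAlgebra ℚ (Mat d) := .restrictScalars ℚ ℝ (Mat d)
  have h := NormedSpace.map_exp (Matrix.toEuclideanCLM (𝕜 := ℝ) (n := Fin d)) continuous_op (t • A)
  rw [map_smul] at h
  exact h

lemma expMat_transpose (A : Mat d) (t : ℝ) : expMat A.transpose t = (expMat A t).transpose := by
  rw [expMat, ← Matrix.transpose_smul, Matrix.exp_transpose, expMat]

lemma expMat_neg_mul (A : Mat d) (t : ℝ) : expMat A (-t) * expMat A t = 1 := by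
  rw [expMat, expMat, ← Matrix.exp_add_of_commute]
  · simp
  · exact (Commute.refl A).smul_left _ |>.smul_right _

lemma adjoint_op (M : Mat d) : ContinuousLinearMap.adjoint (op M) = op M.transpose := by
  rw [← ContinuousLinearMap.star_eq_adjoint, ← Matrix.conjTranspose_eq_transpose_of_trivial]
  exact (map_star (Matrix.toEuclideanCLM (𝕜 := ℝ) (n := Fin d)) M).symm

lemma inner_act_left (M : Mat d) (x y : Vec d) : ⟪act M x, y⟫ = ⟪x, act M.transpose y⟫ := by
  have h := ContinuousLinearMap.adjoint_inner_right (op M) x y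
  rw [adjoint_op] at h
  exact h.symm

lemma act_mul (M N : Mat d) (x : Vec d) : act (M * N) x = act M (act N x) := by
  simp only [act, map_mul]; rfl

lemma transpose_sqrt (S : Mat d) : (CFC.sqrt S).transpose = CFC.sqrt S := by
  have h := (CFC.sqrt_nonneg S).isSelfAdjoint
  rw [← Matrix.conjTranspose_eq_transpose_of_trivial]
  exact h

lemma norm_sq_act_sqrt {S : Mat d} (hS : S.PosSemidef) (x : Vec d) :
    ‖act (CFC.sqrt S) x‖ ^ 2 = x.ofLp ⬝ᵥ S.mulVec x.ofLp := by
  rw [← Matrix.inner_toEuclideanCLM, ← real_inner_self_eq_norm_sq, inner_act_left, transpose_sqrt,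
    ← act_mul, CFC.sqrt_mul_sqrt_self _ hS.nonneg]

lemma continuous_covIntegrand (A Q : Mat d) :
    Continuous (fun r => expMat A r * Q * expMat A.transpose r) :=
  ((continuous_expMat A).matrix_mul continuous_const).matrix_mul (continuous_expMat _)

/-- The entrywise integral commutes with the finite sums of the quadratic form. Positivity of `Q_t`
and the variance of the noise are both read off from this identity. -/
lemma covMat_quadratic {A Q : Mat d} (hQ : Q.PosSemidef) (t : ℝ) (b : Vec d) :
    b.ofLp ⬝ᵥ (covMat A Q t).mulVec b.ofLp =
      ∫ r in (0 : ℝ)..t, ‖act (CFC.sqrt Q) (act (expMat A r).transpose b)‖ ^ 2 := by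
  have hc := continuous_covIntegrand A Q
  have hij : ∀ i j, Continuous (fun r => (expMat A r * Q * expMat A.transpose r) i j) :=
    fun i j => hc.matrix_elem i j
  have hpt : ∀ r, ‖act (CFC.sqrt Q) (act (expMat A r).transpose b)‖ ^ 2 =
      ∑ i, b.ofLp i * ∑ j, (expMat A r * Q * expMat A.transpose r) i j * b.ofLp j := by
    intro r
    rw [norm_sq_act_sqrt hQ, ← Matrix.inner_toEuclideanCLM, inner_act_left, Matrix.transpose_transpose,
      ← act_mul, ← act_mul, ← expMat_transpose, Matrix.inner_toEuclideanCLM]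
    rfl
  simp_rw [hpt]
  rw [intervalIntegral.integral_finsetSum]
  · simp only [dotProduct, Matrix.mulVec, covMat, Matrix.of_apply]
    refine Finset.sum_congr rfl fun i _ => ?_
    rw [intervalIntegral.integral_const_mul, intervalIntegral.integral_finsetSum]
    · simp_rw [intervalIntegral.integral_mul_const]
    · exact fun j _ => ((hij i j).mul continuous_const).intervalIntegrable _ _
  · exact fun i _ => (continuous_const.mul (continuous_finsetSum _ fun j _ =>
      (hij i j).mul continuous_const)).intervalIntegrable _ _

lemma isHermitian_covMat {A Q : Mat d} (hQ : Q.IsHermitian) (t : ℝ) :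
    (covMat A Q t).IsHermitian := by
  ext i j
  simp only [Matrix.conjTranspose_apply, covMat, Matrix.of_apply, star_trivial]
  congr 1; ext r
  have : (expMat A r * Q * expMat A.transpose r).transpose =
      expMat A r * Q * expMat A.transpose r := by
    rw [Matrix.transpose_mul, Matrix.transpose_mul, expMat_transpose, Matrix.transpose_transpose,
      ← Matrix.conjTranspose_eq_transpose_of_trivial Q, hQ.eq, mul_assoc]
  exact congrFun (congrFun this i) j

lemma posSemidef_covMat {A Q : Mat d} (hQ : Q.PosSemidef) {t : ℝ} (ht : 0 ≤ t) :
    (covMat A Q t).PosSemidef := by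
  refine .of_dotProduct_mulVec_nonneg (isHermitian_covMat hQ.isHermitian t) fun x => ?_
  have := covMat_quadratic (A := A) hQ t (WithLp.toLp 2 x)
  simp only [star_trivial]
  change 0 ≤ (WithLp.toLp 2 x).ofLp ⬝ᵥ (covMat A Q t).mulVec (WithLp.toLp 2 x).ofLp
  rw [this]
  exact intervalIntegral.integral_nonneg ht fun _ _ => sq_nonneg _

lemma isUnit_sqrt {S : Mat d} (hS : S.PosDef) : IsUnit (CFC.sqrt S) := by
  have h := hS.isUnit
  rw [← CFC.sqrt_mul_sqrt_self S hS.posSemidef.nonneg, Matrix.isUnit_iff_isUnit_det,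
    Matrix.det_mul] at h
  rw [Matrix.isUnit_iff_isUnit_det]
  exact isUnit_of_mul_isUnit_left h

/-- The vector `b` is recovered from `√Q e^{rA^*} b` by an inverse whose norm is bounded for `r` in
a compact set, so the integrand in `covMat_quadratic` is at least `c ‖b‖ ^ 2`. The linear growth in
`t` produces the rate `t^{-1/2}` for `Λ`. -/
lemma exists_covMat_lower_bound (A : Mat d) {Q : Mat d} (hQ : Q.PosDef) (T : ℝ) :
    ∃ c > 0, ∀ t ∈ Icc 0 T, ∀ b : Vec d,
      c * t * ‖b‖ ^ 2 ≤ b.ofLp ⬝ᵥ (covMat A Q t).mulVec b.ofLp := by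
  have hcont : Continuous (fun r => op ((expMat A (-r)).transpose * (CFC.sqrt Q)⁻¹)) :=
    continuous_op.comp ((((continuous_expMat A).comp continuous_neg).matrix_transpose).matrix_mul
      continuous_const)
  obtain ⟨K, hK⟩ := (isCompact_Icc (a := (0 : ℝ)) (b := T)).exists_bound_of_continuousOn
    hcont.continuousOn
  -- The constant `|K| + 1` is positive even if `Icc 0 T` is empty or `d = 0`.
  have hbd : ∀ r ∈ Icc 0 T, ∀ b : Vec d,
      ‖b‖ ≤ (|K| + 1) * ‖act (CFC.sqrt Q) (act (expMat A r).transpose b)‖ := by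
    intro r hr b
    have h1 : act ((expMat A (-r)).transpose * (CFC.sqrt Q)⁻¹)
        (act (CFC.sqrt Q) (act (expMat A r).transpose b)) = b := by
      rw [← act_mul, ← act_mul, mul_assoc _ _ (CFC.sqrt Q),
        Matrix.nonsing_inv_mul _ ((Matrix.isUnit_iff_isUnit_det _).1 (isUnit_sqrt hQ)), mul_one,
        ← Matrix.transpose_mul]
      have h2 := expMat_neg_mul A (-r)
      rw [neg_neg] at h2
      rw [h2, act, Matrix.transpose_one, map_one, one_apply_eq_self]
    calc
      ‖b‖ = ‖act ((expMat A (-r)).transpose * (CFC.sqrt Q)⁻¹)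
          (act (CFC.sqrt Q) (act (expMat A r).transpose b))‖ := by rw [h1]
      _ ≤ ‖op ((expMat A (-r)).transpose * (CFC.sqrt Q)⁻¹)‖ *
          ‖act (CFC.sqrt Q) (act (expMat A r).transpose b)‖ := ContinuousLinearMap.le_opNorm _ _
      _ ≤ (|K| + 1) * ‖act (CFC.sqrt Q) (act (expMat A r).transpose b)‖ := by
        refine mul_le_mul_of_nonneg_right ?_ (norm_nonneg _)
        exact (hK r hr).trans ((le_abs_self K).trans (by linarith))
  have hK0 : 0 < |K| + 1 := by positivity
  refine ⟨((|K| + 1) ^ 2)⁻¹, by positivity, fun t ht b => ?_⟩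
  rw [covMat_quadratic hQ.posSemidef]
  have hcont2 : Continuous fun r => ‖act (CFC.sqrt Q) (act (expMat A r).transpose b)‖ ^ 2 :=
    (((op (CFC.sqrt Q)).continuous.comp ((continuous_op.comp
      (continuous_expMat A).matrix_transpose).clm_apply continuous_const)).norm).pow 2
  have hint := intervalIntegral.integral_mono_on ht.1
    ((continuous_const (y := ((|K| + 1) ^ 2)⁻¹ * ‖b‖ ^ 2)).intervalIntegrable (μ := volume) _ _)
    (hcont2.intervalIntegrable _ _) (fun r hr => ?_)
  · rw [intervalIntegral.integral_const, smul_eq_mul, sub_zero] at hint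
    linarith
  · rw [inv_mul_le_iff₀ (by positivity), ← mul_pow]
    exact pow_le_pow_left₀ (norm_nonneg _) (hbd r ⟨hr.1, hr.2.trans ht.2⟩ b) 2

lemma posDef_covMat (A : Mat d) {Q : Mat d} (hQ : Q.PosDef) {t : ℝ} (ht : 0 < t) :
    (covMat A Q t).PosDef := by
  refine .of_dotProduct_mulVec_pos (isHermitian_covMat hQ.isHermitian t) fun x hx => ?_
  obtain ⟨c, hc, h⟩ := exists_covMat_lower_bound A hQ t
  have h1 := h t ⟨ht.le, le_rfl⟩ (WithLp.toLp 2 x)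
  simp only [star_trivial]
  refine lt_of_lt_of_le ?_ h1
  have : 0 < ‖(WithLp.toLp 2 x : Vec d)‖ := norm_pos_iff.2 (by simpa using hx)
  positivity

lemma invSqrtCov_mul_sqrt (A : Mat d) {Q : Mat d} (hQ : Q.PosDef) {t : ℝ} (ht : 0 < t) :
    invSqrtCov A Q t * CFC.sqrt (covMat A Q t) = 1 :=
  Matrix.nonsing_inv_mul _
    ((Matrix.isUnit_iff_isUnit_det _).1 (isUnit_sqrt (posDef_covMat A hQ ht)))

lemma sqrt_mul_invSqrtCov (A : Mat d) {Q : Mat d} (hQ : Q.PosDef) {t : ℝ} (ht : 0 < t) :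
    CFC.sqrt (covMat A Q t) * invSqrtCov A Q t = 1 :=
  Matrix.mul_nonsing_inv _
    ((Matrix.isUnit_iff_isUnit_det _).1 (isUnit_sqrt (posDef_covMat A hQ ht)))

/-- The singularity of `Λ` at time `0` is of order `t^{-1/2}`. -/
lemma exists_norm_act_Lam_le (A : Mat d) {Q : Mat d} (hQ : Q.PosDef) (T : ℝ) :
    ∃ C, 0 ≤ C ∧ ∀ t ∈ Ioc 0 T, ∀ v : Vec d, ‖act (Lam A Q t) v‖ ≤ C * (√t)⁻¹ * ‖v‖ := by
  obtain ⟨c, hc, h⟩ := exists_covMat_lower_bound A hQ T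
  obtain ⟨K, hK⟩ := (isCompact_Icc (a := (0 : ℝ)) (b := T)).exists_bound_of_continuousOn
    (continuous_op.comp (continuous_expMat A)).continuousOn
  refine ⟨(√c)⁻¹ * |K|, by positivity, fun t ht v => ?_⟩
  -- At `b = Λ(t) v` the quadratic form of `Q_t` is `‖Q_t^{1/2} Λ(t) v‖ ^ 2 = ‖e^{tA} v‖ ^ 2`, which
  -- is bounded in terms of `v`.
  have h1 := h t ⟨ht.1.le, ht.2⟩ (act (Lam A Q t) v)
  rw [← norm_sq_act_sqrt (posSemidef_covMat hQ.posSemidef ht.1.le), ← act_mul, Lam, ← mul_assoc,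
    sqrt_mul_invSqrtCov A hQ ht.1, one_mul] at h1
  have h2 : ‖act (expMat A t) v‖ ≤ |K| * ‖v‖ :=
    (ContinuousLinearMap.le_opNorm _ _).trans (mul_le_mul_of_nonneg_right
      ((hK t ⟨ht.1.le, ht.2⟩).trans (le_abs_self K)) (norm_nonneg _))
  have hsc : 0 < √c * √t := mul_pos (Real.sqrt_pos.2 hc) (Real.sqrt_pos.2 ht.1)
  have h3 : √c * √t * ‖act (Lam A Q t) v‖ ≤ ‖act (expMat A t) v‖ := by
    refine le_of_sq_le_sq ?_ (norm_nonneg _)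
    rw [mul_pow, mul_pow, Real.sq_sqrt hc.le, Real.sq_sqrt ht.1.le]
    exact h1
  have h4 : (√c)⁻¹ * |K| * (√t)⁻¹ * ‖v‖ = (√c * √t)⁻¹ * (|K| * ‖v‖) := by
    rw [mul_inv]; ring
  rw [h4, le_inv_mul_iff₀ hsc]
  exact h3.trans h2

lemma continuous_covMat (A Q : Mat d) : Continuous (covMat A Q) := by
  refine continuous_matrix fun i j => ?_
  have := (continuous_covIntegrand A Q).matrix_elem i j
  exact intervalIntegral.continuous_primitive (fun a b => this.intervalIntegrable a b) 0

open scoped Matrix.Norms.L2Operator in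
lemma continuousOn_sqrt_covMat (A : Mat d) {Q : Mat d} (hQ : Q.PosSemidef) :
    ContinuousOn (fun t => CFC.sqrt (covMat A Q t)) (Ici 0) :=
  (CFC.continuousOn_sqrt (A := Mat d)).comp (continuous_covMat A Q).continuousOn
    fun _ ht => (posSemidef_covMat hQ ht).nonneg

lemma continuousOn_invSqrtCov (A : Mat d) {Q : Mat d} (hQ : Q.PosDef) :
    ContinuousOn (invSqrtCov A Q) (Ioi 0) := by
  have hR : ContinuousOn (fun t => CFC.sqrt (covMat A Q t)) (Ioi 0) :=
    (continuousOn_sqrt_covMat A hQ.posSemidef).mono Ioi_subset_Ici_self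
  rw [continuousOn_iff_continuous_domRestrict] at hR ⊢
  -- Cramer's formula reduces continuity of the inverse to that of determinant and adjugate.
  have : (Ioi (0 : ℝ)).domRestrict (invSqrtCov A Q) = fun t : Ioi (0 : ℝ) =>
      (CFC.sqrt (covMat A Q t)).det⁻¹ • (CFC.sqrt (covMat A Q t)).adjugate := by
    ext1 t
    rw [Set.domRestrict_apply, invSqrtCov, Matrix.inv_def, Ring.inverse_eq_inv']
  rw [this]
  refine (hR.matrix_det.inv₀ fun t => ?_).smul hR.matrix_adjugate
  exact ((Matrix.isUnit_iff_isUnit_det _).1 (isUnit_sqrt (posDef_covMat A hQ t.2))).ne_zero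

lemma continuousOn_Lam (A : Mat d) {Q : Mat d} (hQ : Q.PosDef) :
    ContinuousOn (Lam A Q) (Ioi 0) := by
  have h1 := continuousOn_invSqrtCov A hQ
  rw [continuousOn_iff_continuous_domRestrict] at h1 ⊢
  exact h1.matrix_mul ((continuous_expMat A).comp continuous_subtype_val)

lemma expMat_sub (A : Mat d) (t u : ℝ) : expMat A (t - u) = expMat A t * expMat A (-u) := by
  rw [expMat, expMat, expMat, ← Matrix.exp_add_of_commute]
  · rw [← add_smul, sub_eq_add_neg]
  · exact (Commute.refl A).smul_left _ |>.smul_right _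

lemma continuous_op_expMat (A : Mat d) : Continuous (fun t => op (expMat A t)) :=
  continuous_op.comp (continuous_expMat A)

lemma continuousOn_expMat_neg (A : Mat d) {f : ℝ → Vec d} {S : Set ℝ} (hf : ContinuousOn f S) :
    ContinuousOn (fun u => act (expMat A (-u)) (f u)) S :=
  ((continuous_op_expMat A).comp continuous_neg).continuousOn.clm_apply hf

/-- Pulling out `e^{tA}` leaves an integrand free of `t`, so continuity in either endpoint follows
from continuity of primitives. -/
lemma shiftInt_eq (A : Mat d) {f : ℝ → Vec d} {s t : ℝ} (hst : s ≤ t)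
    (hf : ContinuousOn f (Icc s t)) :
    shiftInt A f s t = act (expMat A t) (∫ u in s..t, act (expMat A (-u)) (f u)) := by
  rw [shiftInt]
  simp_rw [expMat_sub A t, act_mul]
  exact (op (expMat A t)).intervalIntegral_comp_comm
    ((continuousOn_expMat_neg A hf).intervalIntegrable_of_Icc hst)

lemma continuousOn_shiftInt_right (A : Mat d) {f : ℝ → Vec d} {s t : ℝ} (hst : s ≤ t)
    (hf : ContinuousOn f (Icc s t)) : ContinuousOn (fun r => shiftInt A f s r) (Icc s t) := by
  refine ContinuousOn.congr ?_ fun r hr =>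
    shiftInt_eq A hr.1 (hf.mono (Icc_subset_Icc_right hr.2))
  refine (continuous_op_expMat A).continuousOn.clm_apply ?_
  rw [← uIcc_of_le hst]
  refine intervalIntegral.continuousOn_primitive_interval ?_
  rw [uIcc_of_le hst]
  exact (continuousOn_expMat_neg A hf).integrableOn_Icc

lemma continuousOn_shiftInt_left (A : Mat d) {f : ℝ → Vec d} {s t : ℝ} (hst : s ≤ t)
    (hf : ContinuousOn f (Icc s t)) : ContinuousOn (fun r => shiftInt A f r t) (Icc s t) := by
  refine ContinuousOn.congr ?_ fun r hr =>
    shiftInt_eq A hr.2 (hf.mono (Icc_subset_Icc_left hr.1))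
  refine (op (expMat A t)).continuous.comp_continuousOn ?_
  rw [← uIcc_of_le hst]
  refine intervalIntegral.continuousOn_primitive_interval_left ?_
  rw [uIcc_of_le hst]
  exact (continuousOn_expMat_neg A hf).integrableOn_Icc

end MatrixFacts

/-! ### Cameron–Martin formula and differentiation of Gaussian averages. -/

section GaussianSmoothing

variable {d : ℕ}

/-- Fernique's theorem gives a moment of `exp (C ‖z‖ ^ 2)`; completing the square absorbs `M ‖z‖`.
-/
lemma integrable_exp_mul_norm_stdGaussian (M : ℝ) :
    Integrable (fun z : Vec d => Real.exp (M * ‖z‖)) (stdGaussian (Vec d)) := by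
  obtain ⟨C, hC, hint⟩ := IsGaussian.exists_integrable_exp_sq (stdGaussian (Vec d))
  refine (hint.const_mul (Real.exp (M ^ 2 / (4 * C)))).mono'
    (Continuous.aestronglyMeasurable (by fun_prop)) (ae_of_all _ fun z => ?_)
  rw [Real.norm_of_nonneg (Real.exp_nonneg _), ← Real.exp_add]
  refine Real.exp_le_exp.2 ?_
  have h : M ^ 2 / (4 * C) + C * ‖z‖ ^ 2 - M * ‖z‖ = (M - 2 * C * ‖z‖) ^ 2 / (4 * C) := by
    field_simp; ring
  have : 0 ≤ (M - 2 * C * ‖z‖) ^ 2 / (4 * C) := by positivity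
  linarith

lemma integrable_norm_stdGaussian :
    Integrable (fun z : Vec d => ‖z‖) (stdGaussian (Vec d)) := by
  refine (integrable_exp_mul_norm_stdGaussian (d := d) 1).mono'
    (Continuous.aestronglyMeasurable (by fun_prop)) (ae_of_all _ fun z => ?_)
  rw [norm_norm, one_mul]
  linarith [Real.add_one_le_exp ‖z‖]

/-- The density of the standard Gaussian measure shifted by `u`. -/
def cmDensity (u z : Vec d) : ℝ := Real.exp (⟪u, z⟫ - ‖u‖ ^ 2 / 2)

lemma cmDensity_nonneg (u z : Vec d) : 0 ≤ cmDensity u z := Real.exp_nonneg _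

lemma continuous_cmDensity (u : Vec d) : Continuous (cmDensity u) := by
  unfold cmDensity; fun_prop

lemma cmDensity_le {u : Vec d} {M : ℝ} (hu : ‖u‖ ≤ M) (z : Vec d) :
    cmDensity u z ≤ Real.exp (M * ‖z‖) := by
  refine Real.exp_le_exp.2 ?_
  have h1 := real_inner_le_norm u z
  have h2 := mul_le_mul_of_nonneg_right hu (norm_nonneg z)
  nlinarith [sq_nonneg ‖u‖]

/-- The bound is uniform over `‖u‖ ≤ M`, as required to dominate the derivative of the density in
`u`. -/
lemma cmDensity_mul_norm_sub_le {u : Vec d} {M : ℝ} (hu : ‖u‖ ≤ M) (z : Vec d) :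
    cmDensity u z * ‖z - u‖ ≤ Real.exp M * Real.exp ((M + 1) * ‖z‖) := by
  have h1 : ‖z - u‖ ≤ Real.exp (‖z‖ + M) := by
    have := norm_sub_le z u
    linarith [Real.add_one_le_exp (‖z‖ + M)]
  calc cmDensity u z * ‖z - u‖ ≤ Real.exp (M * ‖z‖) * Real.exp (‖z‖ + M) :=
        mul_le_mul (cmDensity_le hu z) h1 (norm_nonneg _) (Real.exp_nonneg _)
    _ = _ := by rw [← Real.exp_add, ← Real.exp_add]; congr 1; ring

lemma integrable_cmDensity (u : Vec d) : Integrable (cmDensity u) (stdGaussian (Vec d)) :=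
  (integrable_exp_mul_norm_stdGaussian ‖u‖).mono' (continuous_cmDensity u).aestronglyMeasurable
    (ae_of_all _ fun z => by
      rw [Real.norm_of_nonneg (cmDensity_nonneg u z)]; exact cmDensity_le le_rfl z)

/-- Complex coefficients are needed: the shifted density times a Fourier character has exponent `u +
i t`. -/
lemma integral_cexp_sum_mul_stdGaussian (c : Fin d → ℂ) :
    ∫ z, Complex.exp (∑ i, c i * (z.ofLp i : ℂ)) ∂(stdGaussian (Vec d)) =
      Complex.exp (∑ i, c i ^ 2 / 2) := by
  rw [← map_pi_eq_stdGaussian, integral_map (by fun_prop)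
    (Continuous.aestronglyMeasurable (by fun_prop))]
  simp_rw [Complex.exp_sum]
  rw [integral_fintype_prod_eq_prod (f := fun i (x : ℝ) => Complex.exp (c i * x))]
  refine Finset.prod_congr rfl fun i _ => ?_
  have := complexMGF_gaussianReal (p := gaussianReal 0 1) (μ := 0) (v := 1) (X := id)
    Measure.map_id (c i)
  simpa [complexMGF] using this

/-- The Cameron–Martin formula for the standard Gaussian measure. -/
lemma map_const_add_stdGaussian (u : Vec d) :
    (stdGaussian (Vec d)).map (fun z => u + z) =
      (stdGaussian (Vec d)).withDensity (fun z => ENNReal.ofReal (cmDensity u z)) := by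
  have hm : Measurable fun z => ENNReal.ofReal (cmDensity u z) :=
    (continuous_cmDensity u).measurable.ennreal_ofReal
  have : IsFiniteMeasure ((stdGaussian (Vec d)).withDensity
      (fun z => ENNReal.ofReal (cmDensity u z))) :=
    isFiniteMeasure_withDensity_ofReal (integrable_cmDensity u).2
  refine Measure.ext_of_charFun (funext fun t => ?_)
  rw [charFun_apply, charFun_apply, integral_map (by fun_prop)
    (Continuous.aestronglyMeasurable (by fun_prop)),
    integral_withDensity_eq_integral_toReal_smul hm (ae_of_all _ fun _ => ENNReal.ofReal_lt_top)]
  have hin : ∀ x y : Vec d, ((⟪x, y⟫ : ℝ) : ℂ) = ∑ i, (x.ofLp i : ℂ) * (y.ofLp i : ℂ) := by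
    intro x y
    rw [PiLp.inner_apply]
    push_cast
    exact Finset.sum_congr rfl fun i _ => by simp [mul_comm]
  have e1 : ∀ z : Vec d, Complex.exp ((⟪u + z, t⟫ : ℝ) * Complex.I) =
      Complex.exp ((⟪u, t⟫ : ℝ) * Complex.I) *
        Complex.exp (∑ i, (t.ofLp i * Complex.I) * (z.ofLp i : ℂ)) := by
    intro z
    rw [inner_add_left, ← Complex.exp_add]
    push_cast
    rw [hin z t, add_mul, Finset.sum_mul]
    congr 2
    exact Finset.sum_congr rfl fun i _ => by ring
  have e2 : ∀ z : Vec d, (ENNReal.ofReal (cmDensity u z)).toReal •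
      Complex.exp ((⟪z, t⟫ : ℝ) * Complex.I) =
      Complex.exp (-(‖u‖ ^ 2 / 2 : ℝ)) *
        Complex.exp (∑ i, (u.ofLp i + t.ofLp i * Complex.I) * (z.ofLp i : ℂ)) := by
    intro z
    rw [ENNReal.toReal_ofReal (cmDensity_nonneg u z), cmDensity, Complex.real_smul,
      Complex.ofReal_exp, ← Complex.exp_add, ← Complex.exp_add]
    congr 1
    rw [Complex.ofReal_sub, hin u z, hin z t, Finset.sum_mul]
    simp_rw [add_mul]
    rw [Finset.sum_add_distrib]
    have : ∑ i, (z.ofLp i : ℂ) * (t.ofLp i : ℂ) * Complex.I =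
      ∑ i, (t.ofLp i : ℂ) * Complex.I * (z.ofLp i : ℂ) :=
      Finset.sum_congr rfl fun i _ => by ring
    rw [this]; ring
  simp_rw [e1, e2]
  rw [integral_const_mul, integral_const_mul, integral_cexp_sum_mul_stdGaussian,
    integral_cexp_sum_mul_stdGaussian, ← Complex.exp_add, ← Complex.exp_add]
  congr 1
  -- In each coordinate this is `i u t - t ^ 2 / 2 = (u + i t) ^ 2 / 2 - u ^ 2 / 2`.
  rw [EuclideanSpace.real_norm_sq_eq, hin u t, Finset.sum_mul, Finset.sum_div]
  push_cast
  rw [← Finset.sum_add_distrib, ← Finset.sum_neg_distrib, ← Finset.sum_add_distrib]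
  refine Finset.sum_congr rfl fun i _ => ?_
  ring

lemma integral_const_add_stdGaussian {G : Type*} [NormedAddCommGroup G] [NormedSpace ℝ G]
    {h : Vec d → G} (hh : StronglyMeasurable h) (u : Vec d) :
    ∫ z, h (u + z) ∂(stdGaussian (Vec d)) =
      ∫ z, cmDensity u z • h z ∂(stdGaussian (Vec d)) := by
  rw [← integral_map (φ := fun z => u + z) (by fun_prop) hh.aestronglyMeasurable,
    map_const_add_stdGaussian, integral_withDensity_eq_integral_toReal_smul
      (continuous_cmDensity u).measurable.ennreal_ofReal (ae_of_all _ fun _ => ENNReal.ofReal_lt_top)]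
  simp_rw [ENNReal.toReal_ofReal (cmDensity_nonneg u _)]

lemma hasFDerivAt_cmDensity (u z : Vec d) :
    HasFDerivAt (fun u => cmDensity u z) (cmDensity u z • innerSL ℝ (z - u)) u := by
  have h1 : HasFDerivAt (fun u : Vec d => ⟪u, z⟫ - ‖u‖ ^ 2 / 2) (innerSL ℝ (z - u)) u := by
    have ha : HasFDerivAt (fun u : Vec d => ⟪u, z⟫) (innerSL ℝ z) u := by
      simp_rw [real_inner_comm z]
      exact (innerSL ℝ z).hasFDerivAt
    have hb := ((hasStrictFDerivAt_norm_sq u).hasFDerivAt).const_mul (1 / 2 : ℝ)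
    refine (ha.sub hb).congr_fderiv ?_ |>.congr_of_eventuallyEq ?_
    · ext v
      simp
    · exact Eventually.of_forall fun w => by simp; ring
  exact h1.exp

/-- Gaussian smoothing of a bounded measurable function is differentiable, with the
Bismut–Elworthy–Li type derivative. -/
lemma hasFDerivAt_integral_add_stdGaussian {g : Vec d → ℝ} (hg : Measurable g) {C : ℝ}
    (hC : ∀ y, |g y| ≤ C) (u : Vec d) :
    HasFDerivAt (fun u => ∫ z, g (u + z) ∂(stdGaussian (Vec d)))
      (innerSL ℝ (∫ z, g (u + z) • z ∂(stdGaussian (Vec d)))) u := by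
  have hC0 : 0 ≤ C := (abs_nonneg _).trans (hC 0)
  set M := ‖u‖ + 1 with hM
  have hmeas : ∀ v, AEStronglyMeasurable (fun z => cmDensity v z * g z) (stdGaussian (Vec d)) :=
    fun v => ((continuous_cmDensity v).measurable.mul hg).aestronglyMeasurable
  -- After the change of measure `u` occurs only in the smooth density, so differentiation under the
  -- integral is possible for measurable `g`. On the unit ball around `u` all norms are at most `M`.
  have key := hasFDerivAt_integral_of_dominated_of_fderiv_le (μ := stdGaussian (Vec d)) (𝕜 := ℝ)
    (F := fun v z => cmDensity v z * g z)
    (F' := fun v z => g z • (cmDensity v z • innerSL ℝ (z - v)))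
    (bound := fun z => C * (Real.exp M * Real.exp ((M + 1) * ‖z‖)))
    (Metric.ball_mem_nhds u one_pos) (Eventually.of_forall hmeas)
    ((integrable_cmDensity u).mul_bdd (c := C) hg.aestronglyMeasurable (ae_of_all _ hC))
    (hg.aestronglyMeasurable.smul (Continuous.aestronglyMeasurable
      ((continuous_cmDensity u).smul ((innerSL ℝ).continuous.comp (by fun_prop)))))
    (ae_of_all _ fun z v hv => ?_)
    (((integrable_exp_mul_norm_stdGaussian (M + 1)).const_mul _).const_mul _)
    (ae_of_all _ fun z v _ => ?_)
  · have e0 : (fun v => ∫ z, g (v + z) ∂(stdGaussian (Vec d))) =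
        fun v => ∫ z, cmDensity v z * g z ∂(stdGaussian (Vec d)) := by
      ext v
      exact integral_const_add_stdGaussian hg.stronglyMeasurable v
    rw [e0]
    refine key.congr_fderiv ?_
    -- Undoing the shift turns the weight `w - u` under the density back into `z`.
    have e1 : ∀ z, g (u + z) • z = (fun w => g w • (w - u)) (u + z) := fun z => by simp
    simp_rw [e1]
    rw [integral_const_add_stdGaussian (h := fun w => g w • (w - u))
      (hg.smul (by fun_prop)).stronglyMeasurable u]
    have hi : Integrable (fun z => cmDensity u z • g z • (z - u)) (stdGaussian (Vec d)) := by
      refine (((integrable_exp_mul_norm_stdGaussian (M + 1)).const_mul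
        (Real.exp M)).const_mul C).mono' ?_ (ae_of_all _ fun z => ?_)
      · exact ((continuous_cmDensity u).measurable.smul
          (hg.smul (by fun_prop))).aestronglyMeasurable
      · rw [smul_comm, norm_smul, norm_smul, Real.norm_of_nonneg (cmDensity_nonneg u z)]
        exact mul_le_mul (hC z) (cmDensity_mul_norm_sub_le (by linarith) z)
          (mul_nonneg (cmDensity_nonneg u z) (norm_nonneg _)) hC0
    rw [← ContinuousLinearMap.integral_comp_comm _ hi]
    refine integral_congr_ae (ae_of_all _ fun z => ?_)
    simp only [map_smul]
    rw [smul_comm]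
  · rw [norm_smul, norm_smul, innerSL_apply_norm, Real.norm_of_nonneg (cmDensity_nonneg v z)]
    have hv' : ‖v‖ ≤ M := by
      rw [mem_ball_iff_norm] at hv
      have := norm_le_norm_add_norm_sub' v u
      linarith
    exact mul_le_mul (hC z) (cmDensity_mul_norm_sub_le hv' z)
      (mul_nonneg (cmDensity_nonneg v z) (norm_nonneg _)) hC0
  · exact (hasFDerivAt_cmDensity v z).mul_const (g z)

lemma integrable_bdd_smul_stdGaussian {g : Vec d → ℝ} (hg : Measurable g) {C : ℝ}
    (hC : ∀ y, |g y| ≤ C) : Integrable (fun z => g z • z) (stdGaussian (Vec d)) := by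
  refine (integrable_norm_stdGaussian.const_mul C).mono'
    (hg.smul measurable_id).aestronglyMeasurable (ae_of_all _ fun z => ?_)
  rw [norm_smul]
  exact mul_le_mul_of_nonneg_right (hC z) (norm_nonneg _)

/-- The derivative of `y ↦ E[φ(M y + b + R ζ)]` for a standard Gaussian vector `ζ` and an
invertible matrix `R`. -/
lemma hasFDerivAt_integral_affine_stdGaussian {φ : Vec d → ℝ} (hφ : Measurable φ) {C : ℝ}
    (hC : ∀ y, |φ y| ≤ C) {M R R' : Mat d} (hR : R * R' = 1) (b y : Vec d) :
    HasFDerivAt (fun y => ∫ z, φ (act M y + b + act R z) ∂(stdGaussian (Vec d)))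
      ((innerSL ℝ (∫ z, φ (act M y + b + act R z) • z ∂(stdGaussian (Vec d)))).comp
        (op (R' * M))) y := by
  have hg : Measurable fun w => φ (b + act R w) :=
    hφ.comp ((op R).continuous.measurable.const_add b)
  have h := (hasFDerivAt_integral_add_stdGaussian hg (fun w => hC _) (act (R' * M) y)).comp y
    (op (R' * M)).hasFDerivAt
  have e : ∀ y z, b + act R (act (R' * M) y + z) = act M y + b + act R z := by
    intro y z
    rw [show act R (act (R' * M) y + z) = act R (act (R' * M) y) + act R z from map_add (op R) _ _,
      ← act_mul, ← mul_assoc, hR, one_mul]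
    abel
  simp_rw [e] at h
  refine h.congr_of_eventuallyEq (Eventually.of_forall fun y => ?_)
  simp only [Function.comp_apply, e]

/-- The Bismut formula before specialization: with `M = e^{τA}` and `R = Q_τ^{1/2}`, the matrix `R'
* M` is `Λ(τ)`. -/
lemma inner_gradient_integral_affine_stdGaussian {φ : Vec d → ℝ} (hφ : Measurable φ) {C : ℝ}
    (hC : ∀ y, |φ y| ≤ C) {M R R' : Mat d} (hR : R * R' = 1) (b y v : Vec d) :
    ⟪v, ∇ (fun y => ∫ z, φ (act M y + b + act R z) ∂(stdGaussian (Vec d))) y⟫ =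
      ∫ z, φ (act M y + b + act R z) * ⟪act (R' * M) v, z⟫ ∂(stdGaussian (Vec d)) := by
  have h := hasFDerivAt_integral_affine_stdGaussian hφ hC hR (M := M) b y
  rw [gradient, h.fderiv, real_inner_comm, InnerProductSpace.toDual_symm_apply,
    ContinuousLinearMap.comp_apply, innerSL_apply_apply, real_inner_comm]
  have hi := integrable_bdd_smul_stdGaussian
    (g := fun z => φ (act M y + b + act R z))
    (hφ.comp ((op R).continuous.measurable.const_add _)) (fun w => hC _)
  rw [← integral_inner hi]
  simp_rw [real_inner_smul_right]

end GaussianSmoothing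

/-! ### Law and independence of the stochastic convolutions on adjacent intervals. -/

section Noise

variable {d : ℕ} {Ω : Type*} [MeasurableSpace Ω] {P : Measure Ω}

/-- The stochastic convolution `∫_s^t e^{(t-u)A} √Q dW_u`, defined pathwise by integration by
parts. -/
def noise (A Q : Mat d) (W : ℝ≥0 → Ω → Vec d) (s t : ℝ) (ω : Ω) : Vec d :=
  act (CFC.sqrt Q) (W t.toNNReal ω - W s.toNNReal ω) +
    ∫ u in s..t, act (expMat A (t - u)) (act A (act (CFC.sqrt Q)
      (W u.toNNReal ω - W s.toNNReal ω)))

/-- The Riemann sums that approximate `noise`. -/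
def noiseSum (A Q : Mat d) (W : ℝ≥0 → Ω → Vec d) (s t : ℝ) (n : ℕ) (ω : Ω) : Vec d :=
  ∑ k ∈ Finset.range n, act (expMat A (t - node s t n k) * CFC.sqrt Q)
    (W (node s t n (k + 1)).toNNReal ω - W (node s t n k).toNNReal ω)

omit [MeasurableSpace Ω] in
lemma tendsto_noiseSum (A Q : Mat d) {W : ℝ≥0 → Ω → Vec d} {s t : ℝ} (hst : s ≤ t) {ω : Ω}
    (hω : Continuous fun t => W t ω) :
    Tendsto (fun n => noiseSum A Q W s t n ω) atTop (𝓝 (noise A Q W s t ω)) := by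
  have hw : Continuous fun u : ℝ => W u.toNNReal ω - W s.toNNReal ω :=
    (hω.comp continuous_real_toNNReal).sub continuous_const
  have h := tendsto_convolution_sum (op A) (op (CFC.sqrt Q)) hst hw.continuousOn (sub_self _)
  simp only [← op_expMat, sub_sub_sub_cancel_right] at h
  refine h.congr fun n => ?_
  simp only [noiseSum, act_mul]

lemma aemeasurable_noiseSum (A Q : Mat d) {W : ℝ≥0 → Ω → Vec d} (hW : IsBrownianMotion W P)
    (s t : ℝ) (n : ℕ) : AEMeasurable (noiseSum A Q W s t n) P :=
  Finset.aemeasurable_fun_sum _ fun k _ => (op (expMat A (t - node s t n k) *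
    CFC.sqrt Q)).continuous.measurable.comp_aemeasurable
      ((hW.aemeasurable _).sub (hW.aemeasurable _))

lemma aemeasurable_noise (A Q : Mat d) {W : ℝ≥0 → Ω → Vec d} (hW : IsBrownianMotion W P)
    {s t : ℝ} (hst : s ≤ t) : AEMeasurable (noise A Q W s t) P :=
  aemeasurable_of_tendsto_metrizable_ae atTop (fun n => aemeasurable_noiseSum A Q hW s t n)
    (hW.continuous.mono fun _ hω => tendsto_noiseSum A Q hst hω)

/-- The function whose integral is the variance of `⟪noise, b⟫`. -/
def noiseEnergy (A Q : Mat d) (t : ℝ) (b : Vec d) (u : ℝ) : ℝ :=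
  ‖act (CFC.sqrt Q) (act (expMat A (t - u)).transpose b)‖ ^ 2

lemma continuous_noiseEnergy (A Q : Mat d) (t : ℝ) (b : Vec d) :
    Continuous (noiseEnergy A Q t b) :=
  (((op (CFC.sqrt Q)).continuous.comp ((continuous_op.comp ((continuous_expMat A).comp
      (continuous_const.sub continuous_id)).matrix_transpose).clm_apply
        continuous_const)).norm).pow 2

lemma integral_noiseEnergy {A Q : Mat d} (hQ : Q.PosSemidef) (s t : ℝ) (b : Vec d) :
    ∫ u in s..t, noiseEnergy A Q t b u = b.ofLp ⬝ᵥ (covMat A Q (t - s)).mulVec b.ofLp := by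
  rw [covMat_quadratic hQ]
  have := intervalIntegral.integral_comp_sub_left (a := s) (b := t)
    (fun r => ‖act (CFC.sqrt Q) (act (expMat A r).transpose b)‖ ^ 2) t
  rw [sub_self] at this
  exact this

omit [MeasurableSpace Ω] in
lemma inner_noiseSum (A Q : Mat d) (W : ℝ≥0 → Ω → Vec d) (s t : ℝ) (n : ℕ) (ω : Ω) (b : Vec d) :
    ⟪noiseSum A Q W s t n ω, b⟫ = ∑ k ∈ Finset.range n,
      ⟪act (CFC.sqrt Q) (act (expMat A (t - node s t n k)).transpose b),
        W (node s t n (k + 1)).toNNReal ω - W (node s t n k).toNNReal ω⟫ := by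
  rw [noiseSum, sum_inner]
  refine Finset.sum_congr rfl fun k _ => ?_
  rw [inner_act_left, real_inner_comm, Matrix.transpose_mul, transpose_sqrt, act_mul]

/-- Concatenation of the partitions of `[s, r]` and `[r, t]` into `n` intervals each. -/
def node₂ (s r t : ℝ) (n k : ℕ) : ℝ := if k < n then node s r n k else node r t n (k - n)

lemma node₂_left (s r t : ℝ) {n k : ℕ} (hn : n ≠ 0) (hk : k ≤ n) :
    node₂ s r t n k = node s r n k := by
  unfold node₂
  split_ifs with h
  · rfl
  · obtain rfl : k = n := by omega
    rw [Nat.sub_self, node_zero, node_self s r hn]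

lemma node₂_right (s r t : ℝ) (n k : ℕ) : node₂ s r t n (n + k) = node r t n k := by
  simp [node₂]

lemma monotone_node₂ {s r t : ℝ} (hsr : s ≤ r) (hrt : r ≤ t) {n : ℕ} (hn : n ≠ 0) :
    Monotone (node₂ s r t n) := by
  refine monotone_nat_of_le_succ fun k => ?_
  rcases lt_or_ge k n with h | h
  · rw [node₂_left s r t hn h.le, node₂_left s r t hn h]
    exact monotone_node hsr n k.le_succ
  · obtain ⟨j, rfl⟩ := Nat.exists_eq_add_of_le h
    rw [add_assoc, node₂_right, node₂_right]
    exact monotone_node hrt n j.le_succ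

/-- Both sums are written as one sum of increments along a single monotone partition, so the laws
and the independence come out of the same computation. -/
lemma integral_cexp_noiseSum [IsProbabilityMeasure P] (A Q : Mat d) {W : ℝ≥0 → Ω → Vec d}
    (hW : IsBrownianMotion W P) {s r t : ℝ} (hs : 0 ≤ s) (hsr : s ≤ r) (hrt : r ≤ t) {n : ℕ}
    (hn : n ≠ 0) (b₁ b₂ : Vec d) :
    ∫ ω, Complex.exp ((⟪noiseSum A Q W s r n ω, b₁⟫ + ⟪noiseSum A Q W r t n ω, b₂⟫ : ℝ) *
        Complex.I) ∂P =
      Complex.exp (-((∑ k ∈ Finset.range n, noiseEnergy A Q r b₁ (node s r n k) *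
          (node s r n (k + 1) - node s r n k)) +
        ∑ k ∈ Finset.range n, noiseEnergy A Q t b₂ (node r t n k) *
          (node r t n (k + 1) - node r t n k) : ℝ) / 2) := by
  set c : ℕ → Vec d := fun k => if k < n
    then act (CFC.sqrt Q) (act (expMat A (r - node s r n k)).transpose b₁)
    else act (CFC.sqrt Q) (act (expMat A (t - node r t n (k - n))).transpose b₂) with hc
  have hmono := monotone_node₂ hsr hrt hn
  have hpos : ∀ k, 0 ≤ node₂ s r t n k := fun k => by
    refine le_trans ?_ (hmono (Nat.zero_le k))
    rw [node₂_left s r t hn (Nat.zero_le n), node_zero]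
    exact hs
  have key := hW.integral_cexp_sum_increments (τ := fun k => (node₂ s r t n k).toNNReal)
    (fun _ _ hij => Real.toNNReal_mono (hmono hij)) c (n + n)
  simp only [Real.coe_toNNReal _ (hpos _), Finset.sum_range_add, add_assoc, node₂_right] at key
  have hcr : ∀ k, c (n + k) =
      act (CFC.sqrt Q) (act (expMat A (t - node r t n k)).transpose b₂) := fun k => by simp [hc]
  have hcl : ∀ k < n, c k =
      act (CFC.sqrt Q) (act (expMat A (r - node s r n k)).transpose b₁) := fun k hk => by
    simp [hc, hk]
  simp only [hcr] at key
  have e1 : ∀ ω, ∑ k ∈ Finset.range n,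
      ⟪c k, W (node₂ s r t n (k + 1)).toNNReal ω - W (node₂ s r t n k).toNNReal ω⟫ =
        ⟪noiseSum A Q W s r n ω, b₁⟫ := fun ω => by
    rw [inner_noiseSum]
    refine Finset.sum_congr rfl fun k hk => ?_
    rw [Finset.mem_range] at hk
    rw [hcl k hk, node₂_left s r t hn hk, node₂_left s r t hn hk.le]
  have e2 : ∑ k ∈ Finset.range n, ‖c k‖ ^ 2 * (node₂ s r t n (k + 1) - node₂ s r t n k) =
      ∑ k ∈ Finset.range n, noiseEnergy A Q r b₁ (node s r n k) *
          (node s r n (k + 1) - node s r n k) := by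
    refine Finset.sum_congr rfl fun k hk => ?_
    rw [Finset.mem_range] at hk
    rw [hcl k hk, node₂_left s r t hn hk, node₂_left s r t hn hk.le, noiseEnergy]
  simp only [e1, e2, ← inner_noiseSum] at key
  exact key

/-- Pass to the limit in the Riemann sums: the exponentials have modulus one, which dominates the
left side, and the discrete energies converge to `∫ noiseEnergy`. -/
lemma integral_cexp_noise [IsProbabilityMeasure P] (A : Mat d) {Q : Mat d} (hQ : Q.PosSemidef)
    {W : ℝ≥0 → Ω → Vec d}
    (hW : IsBrownianMotion W P) {s r t : ℝ} (hs : 0 ≤ s) (hsr : s ≤ r) (hrt : r ≤ t)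
    (b₁ b₂ : Vec d) :
    ∫ ω, Complex.exp ((⟪noise A Q W s r ω, b₁⟫ + ⟪noise A Q W r t ω, b₂⟫ : ℝ) *
        Complex.I) ∂P =
      Complex.exp (-(b₁.ofLp ⬝ᵥ (covMat A Q (r - s)).mulVec b₁.ofLp +
        b₂.ofLp ⬝ᵥ (covMat A Q (t - r)).mulVec b₂.ofLp : ℝ) / 2) := by
  have hL : Tendsto (fun n => ∫ ω, Complex.exp ((⟪noiseSum A Q W s r n ω, b₁⟫ +
      ⟪noiseSum A Q W r t n ω, b₂⟫ : ℝ) * Complex.I) ∂P) atTop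
      (𝓝 (∫ ω, Complex.exp ((⟪noise A Q W s r ω, b₁⟫ + ⟪noise A Q W r t ω, b₂⟫ : ℝ) *
        Complex.I) ∂P)) := by
    refine tendsto_integral_of_dominated_convergence (fun _ => 1) (fun n => ?_)
      (integrable_const 1) (fun n => ae_of_all _ fun ω => ?_) ?_
    · have h1 := aemeasurable_noiseSum A Q hW s r n
      have h2 := aemeasurable_noiseSum A Q hW r t n
      exact AEMeasurable.aestronglyMeasurable (by fun_prop)
    · rw [Complex.norm_exp_ofReal_mul_I]
    · filter_upwards [hW.continuous] with ω hω
      have h1 := tendsto_noiseSum A Q hsr hω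
      have h2 := tendsto_noiseSum A Q hrt hω
      have hc : Continuous fun x : ℝ => Complex.exp ((x : ℂ) * Complex.I) := by fun_prop
      exact (hc.tendsto _).comp
        ((h1.inner tendsto_const_nhds).add (h2.inner tendsto_const_nhds))
  refine tendsto_nhds_unique hL ?_
  have h1 := tendsto_riemann_sum hsr (continuous_noiseEnergy A Q r b₁).continuousOn
  have h2 := tendsto_riemann_sum hrt (continuous_noiseEnergy A Q t b₂).continuousOn
  rw [integral_noiseEnergy hQ] at h1 h2
  have hc : Continuous fun x : ℝ => Complex.exp (-(x : ℂ) / 2) := by fun_prop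
  refine ((hc.tendsto _).comp (h1.add h2)).congr' ?_
  filter_upwards [eventually_ne_atTop 0] with n hn
  exact (integral_cexp_noiseSum A Q hW hs hsr hrt hn b₁ b₂).symm

/-- Stochastic convolutions over adjacent intervals are independent centered Gaussian vectors,
whose covariances are the matrices `Q_t`. -/
lemma map_noise_prodMk [IsProbabilityMeasure P] (A : Mat d) {Q : Mat d} (hQ : Q.PosSemidef)
    {W : ℝ≥0 → Ω → Vec d}
    (hW : IsBrownianMotion W P) {s r t : ℝ} (hs : 0 ≤ s) (hsr : s ≤ r) (hrt : r ≤ t) :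
    P.map (fun ω => (noise A Q W s r ω, noise A Q W r t ω)) =
      (multivariateGaussian 0 (covMat A Q (r - s))).prod
        (multivariateGaussian 0 (covMat A Q (t - r))) := by
  have hm : AEMeasurable (fun ω => (noise A Q W s r ω, noise A Q W r t ω)) P :=
    (aemeasurable_noise A Q hW hsr).prodMk (aemeasurable_noise A Q hW hrt)
  have : IsProbabilityMeasure (P.map (fun ω => (noise A Q W s r ω, noise A Q W r t ω))) :=
    Measure.isProbabilityMeasure_map hm
  -- Factorization of the joint characteristic function gives the product law.
  refine charFun_eq_prod_iff.1 fun b => ?_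
  rw [charFun_multivariateGaussian (posSemidef_covMat hQ (sub_nonneg.2 hsr)),
    charFun_multivariateGaussian (posSemidef_covMat hQ (sub_nonneg.2 hrt)), ← Complex.exp_add,
    charFun_apply, integral_map (by fun_prop) (Continuous.aestronglyMeasurable (by fun_prop)),
    integral_map hm (Measurable.aestronglyMeasurable (by fun_prop))]
  have h := integral_cexp_noise A hQ hW hs hsr hrt b.ofLp.1 b.ofLp.2
  simp only [WithLp.prod_inner_apply]
  rw [h]
  congr 1
  simp only [inner_zero_right]
  push_cast
  ring

end Noise

/-! ### Flow property of the solution and joint law of state and later noise. -/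

section Representation

variable {d : ℕ} {Ω : Type*} [MeasurableSpace Ω] {P : Measure Ω}

/-- Restarting the integral equation at `r` leaves the forcing `√Q (W_u - W_r)`, to which variation
of constants applies path by path. The exceptional null set is the same for all `r` and `t`. -/
lemma ae_solution_flow {A Q : Mat d} {W : ℝ≥0 → Ω → Vec d}
    (hW : IsBrownianMotion W P) {T s : ℝ} {f : ℝ → Vec d} (hf : ContinuousOn f (Icc s T))
    (hsT : s ≤ T) {x : Vec d} {Y : ℝ → Ω → Vec d} (hY : IsLinearSDESolution P W A Q f T s x Y) :
    ∀ᵐ ω ∂P, Y s ω = x ∧ ∀ r ∈ Icc s T, ∀ t ∈ Icc r T,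
      Y t ω = act (expMat A (t - r)) (Y r ω) + shiftInt A f r t + noise A Q W r t ω := by
  filter_upwards [hY, hW.continuous] with ω hω hWω
  obtain ⟨hc, heq⟩ := hω
  refine ⟨?_, fun r hr t ht => ?_⟩
  · have h := heq s ⟨le_rfl, hsT⟩
    rw [h, intervalIntegral.integral_same, sub_self]
    simp
  have hk : ContinuousOn (fun u => act A (Y u ω) + f u) (Icc s T) :=
    ((op A).continuous.comp_continuousOn hc).add hf
  have hsub : Icc r t ⊆ Icc s T := Icc_subset_Icc hr.1 ht.2
  have hg : Continuous fun u : ℝ => act (CFC.sqrt Q) (W u.toNNReal ω - W r.toNNReal ω) :=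
    (op (CFC.sqrt Q)).continuous.comp
      ((hWω.comp continuous_real_toNNReal).sub continuous_const)
  have h := variation_of_constants (op A) ht.1 (x := Y r ω) (hc.mono hsub) (hf.mono hsub)
    hg.continuousOn fun u hu => by
      have hu' := hsub hu
      have hi : ∀ {a b}, a ∈ Icc s T → b ∈ Icc s T →
          IntervalIntegrable (fun u => act A (Y u ω) + f u) volume a b := fun ha hb =>
        (hk.mono (uIcc_subset_Icc ha hb)).intervalIntegrable
      have hss : s ∈ Icc s T := ⟨le_rfl, hsT⟩
      have h1 := intervalIntegral.integral_add_adjacent_intervals (hi hss hr) (hi hr hu')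
      have h2 : act (CFC.sqrt Q) (W u.toNNReal ω - W s.toNNReal ω) =
          act (CFC.sqrt Q) (W u.toNNReal ω - W r.toNNReal ω) +
            act (CFC.sqrt Q) (W r.toNNReal ω - W s.toNNReal ω) := by
        rw [← sub_add_sub_cancel _ (W r.toNNReal ω)]
        exact map_add (op (CFC.sqrt Q)) _ _
      rw [heq u hu', heq r hr, ← h1, h2]
      abel
  simp only [← op_expMat] at h
  exact h

/-- The law of `Z_{s,r}^x` is the image of the standard Gaussian measure under this map. -/
def stateMap (A Q : Mat d) (f : ℝ → Vec d) (s : ℝ) (x : Vec d) (r : ℝ) (z : Vec d) : Vec d :=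
  act (expMat A (r - s)) x + shiftInt A f s r + act (CFC.sqrt (covMat A Q (r - s))) z

lemma continuous_stateMap (A Q : Mat d) (f : ℝ → Vec d) (s : ℝ) (x : Vec d) (r : ℝ) :
    Continuous (stateMap A Q f s x r) :=
  continuous_const.add (op _).continuous

variable [IsProbabilityMeasure P] {A Q : Mat d} {W : ℝ≥0 → Ω → Vec d} {T s r t : ℝ}
  {f : ℝ → Vec d} {x : Vec d} {Y : ℝ → Ω → Vec d}

/-- The joint law of the state of the solution at time `r` and of the noise after `r`. -/
lemma map_solution_noise (hQ : Q.PosSemidef) (hW : IsBrownianMotion W P)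
    (hf : ContinuousOn f (Icc s T)) (hY : IsLinearSDESolution P W A Q f T s x Y)
    (hs : 0 ≤ s) (hsr : s ≤ r) (hrt : r ≤ t) (htT : t ≤ T) :
    AEMeasurable (Y r) P ∧ P.map (fun ω => (Y r ω, noise A Q W r t ω)) =
      ((stdGaussian (Vec d)).prod (stdGaussian (Vec d))).map
        (fun p => (stateMap A Q f s x r p.1, act (CFC.sqrt (covMat A Q (t - r))) p.2)) := by
  have hflow := ae_solution_flow hW hf (hsr.trans (hrt.trans htT)) hY
  -- The state at `r` is an affine function of the noise on `[s, r]` alone, hence independent of the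
  -- noise on `[r, t]`.
  have hYr : ∀ᵐ ω ∂P, Y r ω =
      act (expMat A (r - s)) x + shiftInt A f s r + noise A Q W s r ω := by
    filter_upwards [hflow] with ω hω
    have h := hω.2 s ⟨le_rfl, hsr.trans (hrt.trans htT)⟩ r ⟨hsr, hrt.trans htT⟩
    rwa [hω.1] at h
  have hn₁ := aemeasurable_noise A Q hW hsr
  have hn₂ := aemeasurable_noise A Q hW hrt
  refine ⟨(hn₁.const_add _).congr (hYr.mono fun ω h => h.symm), ?_⟩
  set g : Vec d × Vec d → Vec d × Vec d :=
    fun p => (act (expMat A (r - s)) x + shiftInt A f s r + p.1, p.2) with hg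
  have hgm : Measurable g := by fun_prop
  have e1 : (fun ω => (Y r ω, noise A Q W r t ω)) =ᵐ[P]
      g ∘ fun ω => (noise A Q W s r ω, noise A Q W r t ω) :=
    hYr.mono fun ω h => by simp [hg, h]
  rw [Measure.map_congr e1, ← AEMeasurable.map_map_of_aemeasurable hgm.aemeasurable
    (hn₁.prodMk hn₂), map_noise_prodMk A hQ hW hs hsr hrt, multivariateGaussian,
    multivariateGaussian, Measure.map_prod_map _ _ (by fun_prop) (by fun_prop),
    Measure.map_map hgm (by fun_prop)]
  congr 1
  ext1 p
  simp [hg, stateMap]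

lemma integrable_comp_solution_noise_iff (hQ : Q.PosSemidef) (hW : IsBrownianMotion W P)
    (hf : ContinuousOn f (Icc s T)) (hY : IsLinearSDESolution P W A Q f T s x Y)
    (hs : 0 ≤ s) (hsr : s ≤ r) (hrt : r ≤ t) (htT : t ≤ T)
    {g : Vec d × Vec d → ℝ} (hg : Measurable g) :
    Integrable (fun ω => g (Y r ω, noise A Q W r t ω)) P ↔
      Integrable (fun p => g (stateMap A Q f s x r p.1, act (CFC.sqrt (covMat A Q (t - r))) p.2))
        ((stdGaussian (Vec d)).prod (stdGaussian (Vec d))) := by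
  obtain ⟨hm, hl⟩ := map_solution_noise hQ hW hf hY hs hsr hrt htT
  have hn := aemeasurable_noise A Q hW hrt
  have hst := continuous_stateMap A Q f s x r
  have h1 := integrable_map_measure (μ := P) (f := fun ω => (Y r ω, noise A Q W r t ω)) (g := g)
    hg.aestronglyMeasurable (hm.prodMk hn)
  rw [hl, integrable_map_measure hg.aestronglyMeasurable (by fun_prop)] at h1
  exact h1.symm

lemma integral_comp_solution_noise (hQ : Q.PosSemidef) (hW : IsBrownianMotion W P)
    (hf : ContinuousOn f (Icc s T)) (hY : IsLinearSDESolution P W A Q f T s x Y)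
    (hs : 0 ≤ s) (hsr : s ≤ r) (hrt : r ≤ t) (htT : t ≤ T)
    {g : Vec d × Vec d → ℝ} (hg : Measurable g) :
    ∫ ω, g (Y r ω, noise A Q W r t ω) ∂P =
      ∫ p, g (stateMap A Q f s x r p.1, act (CFC.sqrt (covMat A Q (t - r))) p.2)
        ∂((stdGaussian (Vec d)).prod (stdGaussian (Vec d))) := by
  obtain ⟨hm, hl⟩ := map_solution_noise hQ hW hf hY hs hsr hrt htT
  have hn := aemeasurable_noise A Q hW hrt
  have hst := continuous_stateMap A Q f s x r
  have h1 := integral_map (μ := P) (φ := fun ω => (Y r ω, noise A Q W r t ω)) (f := g)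
    (hm.prodMk hn) hg.aestronglyMeasurable
  rw [hl, integral_map (by fun_prop) hg.aestronglyMeasurable] at h1
  exact h1.symm

lemma map_solution (hQ : Q.PosSemidef) (hW : IsBrownianMotion W P)
    (hf : ContinuousOn f (Icc s T)) (hY : IsLinearSDESolution P W A Q f T s x Y)
    (hs : 0 ≤ s) (hsr : s ≤ r) (hrT : r ≤ T) :
    P.map (Y r) = (stdGaussian (Vec d)).map (stateMap A Q f s x r) := by
  -- The case `t = r` suffices: only the first marginal is kept.
  obtain ⟨hm, hl⟩ := map_solution_noise hQ hW hf hY hs hsr le_rfl hrT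
  have hn := aemeasurable_noise A Q hW (le_refl r)
  have hst := continuous_stateMap A Q f s x r
  have h := congrArg (Measure.map Prod.fst) hl
  rw [AEMeasurable.map_map_of_aemeasurable measurable_fst.aemeasurable (hm.prodMk hn),
    Measure.map_map measurable_fst (by fun_prop)] at h
  have e : (Prod.fst ∘ fun p : Vec d × Vec d =>
      (stateMap A Q f s x r p.1, act (CFC.sqrt (covMat A Q (r - r))) p.2)) =
      stateMap A Q f s x r ∘ Prod.fst := rfl
  rw [e, ← Measure.map_map hst.measurable measurable_fst, Measure.map_fst_prod, measure_univ,
    one_smul] at h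
  exact h

end Representation

/-! ### The function `v^0` as a Gaussian average, and its gradient. -/

section FirstIncrement

variable {d : ℕ} {Ω : Type*} [MeasurableSpace Ω] {P : Measure Ω} [IsProbabilityMeasure P]
  {A Q : Mat d} {W : ℝ≥0 → Ω → Vec d} {T s r t : ℝ} {f : ℝ → Vec d} {x : Vec d}
  {Z : ℝ → Vec d → ℝ → Ω → Vec d} {B : ℝ → Vec d → Vec d} {φ : Vec d → ℝ}

lemma incr_zero_eq (hQ : Q.PosSemidef) (hW : IsBrownianMotion W P)
    (hf : ContinuousOn f (Icc 0 T))
    (hZ : ∀ s ∈ Icc 0 T, ∀ x, IsLinearSDESolution P W A Q f T s x (Z s x))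
    (hφ : Measurable φ) (hr : 0 ≤ r) (hrt : r ≤ t) (htT : t ≤ T) :
    incr P Z B φ 0 r t = fun y => ∫ z, φ (act (expMat A (t - r)) y + shiftInt A f r t +
      act (CFC.sqrt (covMat A Q (t - r))) z) ∂(stdGaussian (Vec d)) := by
  ext y
  have hY := hZ r ⟨hr, hrt.trans htT⟩ y
  have hfr := hf.mono (Icc_subset_Icc_left hr)
  have hm := (map_solution_noise hQ hW hfr hY hr hrt le_rfl htT).1
  have hl := map_solution hQ hW hfr hY hr hrt htT
  change ∫ ω, φ (Z r y t ω) ∂P = _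
  rw [← integral_map hm hφ.aestronglyMeasurable, hl,
    integral_map (continuous_stateMap A Q f r y t).measurable.aemeasurable hφ.aestronglyMeasurable]
  rfl

/-- The integrand of the Gaussian representation of `⟪B, D v^0⟫`. -/
def bismut (A Q : Mat d) (f : ℝ → Vec d) (B : ℝ → Vec d → Vec d) (φ : Vec d → ℝ) (r t : ℝ)
    (y z : Vec d) : ℝ :=
  φ (act (expMat A (t - r)) y + shiftInt A f r t + act (CFC.sqrt (covMat A Q (t - r))) z) *
    ⟪act (Lam A Q (t - r)) (B r y), z⟫

lemma inner_gradient_incr_zero (hQ : Q.PosDef) (hW : IsBrownianMotion W P)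
    (hf : ContinuousOn f (Icc 0 T))
    (hZ : ∀ s ∈ Icc 0 T, ∀ x, IsLinearSDESolution P W A Q f T s x (Z s x))
    (hφ : Measurable φ) {C : ℝ} (hC : ∀ y, |φ y| ≤ C)
    (hr : 0 ≤ r) (hrt : r < t) (htT : t ≤ T) (y : Vec d) :
    ⟪B r y, ∇ (incr P Z B φ 0 r t) y⟫ = ∫ z, bismut A Q f B φ r t y z ∂(stdGaussian (Vec d)) := by
  rw [incr_zero_eq hQ.posSemidef hW hf hZ hφ hr hrt.le htT]
  exact inner_gradient_integral_affine_stdGaussian hφ hC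
    (sqrt_mul_invSqrtCov A hQ (sub_pos.2 hrt)) _ _ _

lemma differentiable_incr_zero (hQ : Q.PosDef) (hW : IsBrownianMotion W P)
    (hf : ContinuousOn f (Icc 0 T))
    (hZ : ∀ s ∈ Icc 0 T, ∀ x, IsLinearSDESolution P W A Q f T s x (Z s x))
    (hφ : Measurable φ) {C : ℝ} (hC : ∀ y, |φ y| ≤ C)
    (hr : 0 ≤ r) (hrt : r < t) (htT : t ≤ T) :
    Differentiable ℝ (incr P Z B φ 0 r t) := by
  rw [incr_zero_eq hQ.posSemidef hW hf hZ hφ hr hrt.le htT]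
  exact fun y => (hasFDerivAt_integral_affine_stdGaussian hφ hC
    (sqrt_mul_invSqrtCov A hQ (sub_pos.2 hrt)) _ y).differentiableAt

end FirstIncrement

/-! ### Joint measurability and the moment bound for the Bismut integrand. -/

section BismutIntegrand

variable {d : ℕ} {A Q : Mat d} {s r t : ℝ} {f : ℝ → Vec d} {x : Vec d}
  {B : ℝ → Vec d → Vec d} {φ : Vec d → ℝ}

lemma measurable_bismut (hφ : Measurable φ) (hB : Measurable (B r)) :
    Measurable (fun p : Vec d × Vec d => bismut A Q f B φ r t p.1 p.2) := by
  have h1 : Measurable fun p : Vec d × Vec d => act (expMat A (t - r)) p.1 :=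
    (op (expMat A (t - r))).continuous.measurable.comp measurable_fst
  have h2 : Measurable fun p : Vec d × Vec d => act (CFC.sqrt (covMat A Q (t - r))) p.2 :=
    (op (CFC.sqrt (covMat A Q (t - r)))).continuous.measurable.comp measurable_snd
  have h3 : Measurable fun p : Vec d × Vec d => act (Lam A Q (t - r)) (B r p.1) :=
    (op (Lam A Q (t - r))).continuous.measurable.comp (hB.comp measurable_fst)
  exact (hφ.comp ((h1.add_const _).add h2)).mul (h3.inner measurable_snd)

lemma continuous_act_apply {X : Type*} [TopologicalSpace X] {M : X → Mat d} {v : X → Vec d}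
    (hM : Continuous M) (hv : Continuous v) : Continuous fun p => act (M p) (v p) :=
  (continuous_op.comp hM).clm_apply hv

lemma continuous_stateMap_uncurry (hQ : Q.PosSemidef) (hst : s ≤ t)
    (hf : ContinuousOn f (Icc s t)) :
    Continuous (fun p : Ioo s t × Vec d => stateMap A Q f s x p.1 p.2) := by
  have h1 : Continuous fun p : Ioo s t × Vec d => act (expMat A (p.1 - s)) x :=
    continuous_act_apply ((continuous_expMat A).comp (by fun_prop)) continuous_const
  have h2 : Continuous fun p : Ioo s t × Vec d => shiftInt A f s p.1 :=
    (continuousOn_shiftInt_right A hst hf).comp_continuous (by fun_prop)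
      fun p => Ioo_subset_Icc_self p.1.2
  have h3 : Continuous fun p : Ioo s t × Vec d => act (CFC.sqrt (covMat A Q (p.1 - s))) p.2 :=
    continuous_act_apply ((continuousOn_sqrt_covMat A hQ).comp_continuous
      (f := fun p : Ioo s t × Vec d => (p.1 : ℝ) - s) (by fun_prop)
      fun p => sub_nonneg.2 p.1.2.1.le) continuous_snd
  exact (h1.add h2).add h3

/-- Time lives in the subtype `Ioo s t`: there `t - r > 0`, so `Λ(t - r)` is continuous in `r`, and
`f` and `B` are controlled. -/
lemma measurable_bismut_uncurry (hQ : Q.PosDef) (hst : s ≤ t) (hf : ContinuousOn f (Icc s t))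
    (hφ : Measurable φ) (hB : Measurable (fun p : Ioo s t × Vec d => B p.1 p.2)) :
    Measurable (fun p : Ioo s t × (Vec d × Vec d) =>
      bismut A Q f B φ p.1 t (stateMap A Q f s x p.1 p.2.1) p.2.2) := by
  have hy : Continuous fun p : Ioo s t × (Vec d × Vec d) => stateMap A Q f s x p.1 p.2.1 := by
    have hp : Continuous fun p : Ioo s t × (Vec d × Vec d) => (p.1, p.2.1) := by fun_prop
    have hc := continuous_stateMap_uncurry (A := A) (x := x) hQ.posSemidef hst hf
    simpa only [Function.comp_def] using hc.comp hp
  have hτ : Continuous fun p : Ioo s t × (Vec d × Vec d) => t - (p.1 : ℝ) := by fun_prop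
  have hτ0 : ∀ p : Ioo s t × (Vec d × Vec d), t - (p.1 : ℝ) ∈ Ioi (0 : ℝ) :=
    fun p => sub_pos.2 p.1.2.2
  have h1 : Continuous fun p : Ioo s t × (Vec d × Vec d) =>
      act (expMat A (t - p.1)) (stateMap A Q f s x p.1 p.2.1) :=
    continuous_act_apply ((continuous_expMat A).comp hτ) hy
  have h2 : Continuous fun p : Ioo s t × (Vec d × Vec d) => shiftInt A f p.1 t :=
    (continuousOn_shiftInt_left A hst hf).comp_continuous (by fun_prop)
      fun p => Ioo_subset_Icc_self p.1.2
  have h3 : Continuous fun p : Ioo s t × (Vec d × Vec d) =>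
      act (CFC.sqrt (covMat A Q (t - p.1))) p.2.2 :=
    continuous_act_apply ((continuousOn_sqrt_covMat A hQ.posSemidef).comp_continuous hτ
      fun p => Ioi_subset_Ici_self (hτ0 p)) (continuous_snd.comp continuous_snd)
  have h4 : Continuous fun p : Ioo s t × (Vec d × Vec d) => Lam A Q (t - p.1) :=
    (continuousOn_Lam A hQ).comp_continuous hτ hτ0
  have h5 : Measurable fun p : Ioo s t × (Vec d × Vec d) =>
      B p.1 (stateMap A Q f s x p.1 p.2.1) :=
    hB.comp (measurable_fst.prodMk hy.measurable)
  have h6 : Measurable fun p : Ioo s t × (Vec d × Vec d) =>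
      act (Lam A Q (t - p.1)) (B p.1 (stateMap A Q f s x p.1 p.2.1)) := by
    have hc : Continuous fun q : (Ioo s t × (Vec d × Vec d)) × Vec d =>
        act (Lam A Q (t - q.1.1)) q.2 :=
      continuous_act_apply (by simpa only [Function.comp_def] using h4.comp continuous_fst)
        continuous_snd
    simpa only [Function.comp_def, id_eq] using hc.measurable.comp (measurable_id.prodMk h5)
  exact (hφ.comp ((h1.add h2).add h3).measurable).mul
    (h6.inner (measurable_snd.comp measurable_snd))

lemma exists_lintegral_enorm_bismut_le (A : Mat d) (hQ : Q.PosDef) {C : ℝ}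
    (hC : ∀ y, |φ y| ≤ C) (hs : 0 ≤ s) (f : ℝ → Vec d) (x : Vec d) (t : ℝ) :
    ∃ K : ℝ, ∀ r ∈ Ioo s t, Measurable (B r) →
      ∫⁻ p, ‖bismut A Q f B φ r t (stateMap A Q f s x r p.1) p.2‖ₑ
          ∂((stdGaussian (Vec d)).prod (stdGaussian (Vec d))) ≤
        ENNReal.ofReal K * (ENNReal.ofReal (√(t - r))⁻¹ *
          ∫⁻ z, ‖B r (stateMap A Q f s x r z)‖ₑ ∂(stdGaussian (Vec d))) := by
  obtain ⟨L, hL0, hL⟩ := exists_norm_act_Lam_le A hQ t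
  have hC0 : 0 ≤ C := (abs_nonneg _).trans (hC 0)
  set m : ℝ := ∫ z, ‖z‖ ∂(stdGaussian (Vec d)) with hm
  have hm' : ∫⁻ z, ‖z‖ₑ ∂(stdGaussian (Vec d)) = ENNReal.ofReal m :=
    (ofReal_integral_norm_eq_lintegral_enorm
      ((integrable_norm_iff (by fun_prop)).1 integrable_norm_stdGaussian)).symm
  -- The factors are the bound of `φ`, the constant in `‖Λ(τ)‖ ≤ L τ^{-1/2}`, and the mean of `‖z‖`,
  -- split off by the product structure.
  refine ⟨C * L * m, fun r hr hB => ?_⟩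
  have hτ : t - r ∈ Ioc 0 t := ⟨sub_pos.2 hr.2, by linarith [hr.1]⟩
  have hst := (continuous_stateMap A Q f s x r).measurable
  have hpt : ∀ p : Vec d × Vec d, ‖bismut A Q f B φ r t (stateMap A Q f s x r p.1) p.2‖ₑ ≤
      ENNReal.ofReal (C * L) * (ENNReal.ofReal (√(t - r))⁻¹ *
        (‖B r (stateMap A Q f s x r p.1)‖ₑ * ‖p.2‖ₑ)) := by
    intro p
    rw [← ofReal_norm, ← ofReal_norm, ← ofReal_norm, ← ENNReal.ofReal_mul (norm_nonneg _),
      ← ENNReal.ofReal_mul (by positivity), ← ENNReal.ofReal_mul (by positivity)]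
    refine ENNReal.ofReal_le_ofReal ?_
    rw [bismut, norm_mul]
    have h1 := (norm_inner_le_norm (𝕜 := ℝ)
      (act (Lam A Q (t - r)) (B r (stateMap A Q f s x r p.1))) p.2).trans
      (mul_le_mul_of_nonneg_right (hL _ hτ _) (norm_nonneg _))
    refine (mul_le_mul (hC _) h1 (norm_nonneg _) hC0).trans (le_of_eq ?_)
    ring
  refine (lintegral_mono hpt).trans (le_of_eq ?_)
  rw [lintegral_const_mul' _ _ ENNReal.ofReal_ne_top, lintegral_const_mul' _ _ ENNReal.ofReal_ne_top,
    lintegral_prod_mul (f := fun z => ‖B r (stateMap A Q f s x r z)‖ₑ) (g := fun z => ‖z‖ₑ)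
      (hB.comp hst).enorm.aemeasurable measurable_enorm.aemeasurable, hm',
    ENNReal.ofReal_mul (mul_nonneg hC0 hL0)]
  ring

end BismutIntegrand

/-! ### Identification of the weighted expectation with the Bismut integral. -/

section FirstIncrementFormula

variable {d : ℕ} {Ω : Type*} [MeasurableSpace Ω] {P : Measure Ω} [IsProbabilityMeasure P]
  {A Q : Mat d} {W : ℝ≥0 → Ω → Vec d} {T s r t : ℝ} {f : ℝ → Vec d} {x : Vec d}
  {Z : ℝ → Vec d → ℝ → Ω → Vec d} {B : ℝ → Vec d → Vec d} {φ : Vec d → ℝ}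

/-- The function of the state at time `r` and of the noise after `r` that represents `weighted`. -/
def weightedFun (A Q : Mat d) (f : ℝ → Vec d) (B : ℝ → Vec d → Vec d) (φ : Vec d → ℝ) (r t : ℝ)
    (p : Vec d × Vec d) : ℝ :=
  φ (act (expMat A (t - r)) p.1 + shiftInt A f r t + p.2) *
    ⟪act (Lam A Q (t - r)) (B r p.1), act (invSqrtCov A Q (t - r)) p.2⟫

lemma measurable_weightedFun (hφ : Measurable φ) (hB : Measurable (B r)) :
    Measurable (weightedFun A Q f B φ r t) := by
  have h1 : Measurable fun p : Vec d × Vec d => act (expMat A (t - r)) p.1 :=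
    (op (expMat A (t - r))).continuous.measurable.comp measurable_fst
  have h2 : Measurable fun p : Vec d × Vec d => act (invSqrtCov A Q (t - r)) p.2 :=
    (op (invSqrtCov A Q (t - r))).continuous.measurable.comp measurable_snd
  have h3 : Measurable fun p : Vec d × Vec d => act (Lam A Q (t - r)) (B r p.1) :=
    (op (Lam A Q (t - r))).continuous.measurable.comp (hB.comp measurable_fst)
  exact (hφ.comp ((h1.add_const _).add measurable_snd)).mul (h3.inner h2)

/-- The factor `Q_{t-r}^{-1/2}` cancels the square root in the noise, leaving the standard Gaussian
variable. -/
lemma weightedFun_stateMap (hQ : Q.PosDef) (hrt : r < t) (p : Vec d × Vec d) :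
    weightedFun A Q f B φ r t
      (stateMap A Q f s x r p.1, act (CFC.sqrt (covMat A Q (t - r))) p.2) =
      bismut A Q f B φ r t (stateMap A Q f s x r p.1) p.2 := by
  have h : act (invSqrtCov A Q (t - r)) (act (CFC.sqrt (covMat A Q (t - r))) p.2) = p.2 := by
    rw [← act_mul, invSqrtCov_mul_sqrt A hQ (sub_pos.2 hrt), act, map_one, one_apply_eq_self]
  rw [weightedFun, bismut, h]

omit [IsProbabilityMeasure P] in
lemma weighted_ae_eq (hW : IsBrownianMotion W P)
    (hf : ContinuousOn f (Icc s T)) (hY : IsLinearSDESolution P W A Q f T s x (Z s x))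
    (hsr : s ≤ r) (hrt : r ≤ t) (htT : t ≤ T) :
    weighted A Q f Z B φ s t x r =ᵐ[P]
      fun ω => weightedFun A Q f B φ r t (Z s x r ω, noise A Q W r t ω) := by
  filter_upwards [ae_solution_flow hW hf (hsr.trans (hrt.trans htT)) hY] with ω hω
  have h := hω.2 r ⟨hsr, hrt.trans htT⟩ t ⟨hrt, htT⟩
  have h' : Z s x t ω - act (expMat A (t - r)) (Z s x r ω) - shiftInt A f r t =
      noise A Q W r t ω := by rw [h]; abel
  rw [weighted, weightedFun, h', h]

lemma integrable_weighted_iff (hQ : Q.PosDef) (hW : IsBrownianMotion W P)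
    (hf : ContinuousOn f (Icc s T)) (hY : IsLinearSDESolution P W A Q f T s x (Z s x))
    (hφ : Measurable φ) (hB : Measurable (B r))
    (hs : 0 ≤ s) (hsr : s ≤ r) (hrt : r < t) (htT : t ≤ T) :
    Integrable (weighted A Q f Z B φ s t x r) P ↔
      Integrable (fun p => bismut A Q f B φ r t (stateMap A Q f s x r p.1) p.2)
        ((stdGaussian (Vec d)).prod (stdGaussian (Vec d))) := by
  rw [integrable_congr (weighted_ae_eq hW hf hY hsr hrt.le htT),
    integrable_comp_solution_noise_iff hQ.posSemidef hW hf hY hs hsr hrt.le htT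
      (measurable_weightedFun hφ hB)]
  simp only [weightedFun_stateMap hQ hrt]

lemma integral_weighted (hQ : Q.PosDef) (hW : IsBrownianMotion W P)
    (hf : ContinuousOn f (Icc s T)) (hY : IsLinearSDESolution P W A Q f T s x (Z s x))
    (hφ : Measurable φ) (hB : Measurable (B r))
    (hs : 0 ≤ s) (hsr : s ≤ r) (hrt : r < t) (htT : t ≤ T) :
    ∫ ω, weighted A Q f Z B φ s t x r ω ∂P =
      ∫ p, bismut A Q f B φ r t (stateMap A Q f s x r p.1) p.2
        ∂((stdGaussian (Vec d)).prod (stdGaussian (Vec d))) := by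
  rw [integral_congr_ae (weighted_ae_eq hW hf hY hsr hrt.le htT),
    integral_comp_solution_noise hQ.posSemidef hW hf hY hs hsr hrt.le htT
      (measurable_weightedFun hφ hB)]
  simp only [weightedFun_stateMap hQ hrt]

lemma measurable_integral_bismut (hφ : Measurable φ) (hB : Measurable (B r)) :
    Measurable fun y => ∫ z, bismut A Q f B φ r t y z ∂(stdGaussian (Vec d)) :=
  ((measurable_bismut (A := A) (Q := Q) (f := f) (t := t) hφ
    hB).stronglyMeasurable.integral_prod_right').measurable

lemma integrable_integral_bismut (hQ : Q.PosSemidef) (hW : IsBrownianMotion W P)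
    (hf : ContinuousOn f (Icc s T)) (hY : IsLinearSDESolution P W A Q f T s x (Z s x))
    (hφ : Measurable φ) (hB : Measurable (B r))
    (hs : 0 ≤ s) (hsr : s ≤ r) (hrT : r ≤ T)
    (hi : Integrable (fun p => bismut A Q f B φ r t (stateMap A Q f s x r p.1) p.2)
        ((stdGaussian (Vec d)).prod (stdGaussian (Vec d)))) :
    Integrable (fun ω => ∫ z, bismut A Q f B φ r t (Z s x r ω) z ∂(stdGaussian (Vec d))) P := by
  have hm := (map_solution_noise hQ hW hf hY hs hsr le_rfl hrT).1
  have hD := measurable_integral_bismut (A := A) (Q := Q) (f := f) (t := t) hφ hB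
  have h := integrable_map_measure (μ := P) hD.aestronglyMeasurable hm
  rw [map_solution hQ hW hf hY hs hsr hrT, integrable_map_measure hD.aestronglyMeasurable
    (continuous_stateMap A Q f s x r).measurable.aemeasurable] at h
  exact h.1 hi.integral_prod_left

lemma integral_integral_bismut (hQ : Q.PosSemidef) (hW : IsBrownianMotion W P)
    (hf : ContinuousOn f (Icc s T)) (hY : IsLinearSDESolution P W A Q f T s x (Z s x))
    (hφ : Measurable φ) (hB : Measurable (B r))
    (hs : 0 ≤ s) (hsr : s ≤ r) (hrT : r ≤ T)
    (hi : Integrable (fun p => bismut A Q f B φ r t (stateMap A Q f s x r p.1) p.2)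
        ((stdGaussian (Vec d)).prod (stdGaussian (Vec d)))) :
    ∫ ω, ∫ z, bismut A Q f B φ r t (Z s x r ω) z ∂(stdGaussian (Vec d)) ∂P =
      ∫ p, bismut A Q f B φ r t (stateMap A Q f s x r p.1) p.2
        ∂((stdGaussian (Vec d)).prod (stdGaussian (Vec d))) := by
  have hm := (map_solution_noise hQ hW hf hY hs hsr le_rfl hrT).1
  have hD := measurable_integral_bismut (A := A) (Q := Q) (f := f) (t := t) hφ hB
  rw [← integral_map hm (f := fun y => ∫ z, bismut A Q f B φ r t y z ∂(stdGaussian (Vec d)))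
    hD.aestronglyMeasurable, map_solution hQ hW hf hY hs hsr hrT,
    integral_map (continuous_stateMap A Q f s x r).measurable.aemeasurable hD.aestronglyMeasurable,
    integral_prod _ hi]

lemma lintegral_enorm_drift (hQ : Q.PosSemidef) (hW : IsBrownianMotion W P)
    (hf : ContinuousOn f (Icc s T)) (hY : IsLinearSDESolution P W A Q f T s x (Z s x))
    (hB : Measurable (B r)) (hs : 0 ≤ s) (hsr : s ≤ r) (hrT : r ≤ T) :
    ∫⁻ ω, ‖B r (Z s x r ω)‖ₑ ∂P =
      ∫⁻ z, ‖B r (stateMap A Q f s x r z)‖ₑ ∂(stdGaussian (Vec d)) := by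
  have hm := (map_solution_noise hQ hW hf hY hs hsr le_rfl hrT).1
  rw [← lintegral_map' (f := fun y => ‖B r y‖ₑ) hB.enorm.aemeasurable hm,
    map_solution hQ hW hf hY hs hsr hrT,
    lintegral_map hB.enorm (continuous_stateMap A Q f s x r).measurable]

/-- Under the moment condition on the drift, the Gaussian representation of `⟪B, D v^0⟫` is
integrable in space, and its space integral is integrable in time. -/
lemma integrable_bismut (hQ : Q.PosDef) (hst : s ≤ t) (hs : 0 ≤ s)
    (hf : ContinuousOn f (Icc s t))
    (hφ : Measurable φ) {C : ℝ} (hC : ∀ y, |φ y| ≤ C)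
    (hB : Measurable (fun p : Ioo s t × Vec d => B p.1 p.2))
    (hint : ∫⁻ r in Ioo s t, ENNReal.ofReal (√(t - r))⁻¹ *
      ∫⁻ z, ‖B r (stateMap A Q f s x r z)‖ₑ ∂(stdGaussian (Vec d)) < ⊤) :
    (∀ᵐ r ∂(volume.restrict (Ioo s t)),
      Integrable (fun p => bismut A Q f B φ r t (stateMap A Q f s x r p.1) p.2)
        ((stdGaussian (Vec d)).prod (stdGaussian (Vec d)))) ∧
    IntegrableOn (fun r => ∫ p, bismut A Q f B φ r t (stateMap A Q f s x r p.1) p.2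
        ∂((stdGaussian (Vec d)).prod (stdGaussian (Vec d)))) (Ioo s t) := by
  have hBr : ∀ r ∈ Ioo s t, Measurable (B r) := fun r hr =>
    hB.comp (measurable_const (a := (⟨r, hr⟩ : Ioo s t)).prodMk measurable_id)
  have hJ := measurable_bismut_uncurry (A := A) (x := x) hQ hst hf hφ hB
  obtain ⟨K, hK⟩ := exists_lintegral_enorm_bismut_le (B := B) A hQ hC hs f x t
  have hme : MeasurableEmbedding ((↑) : Ioo s t → ℝ) := .subtype_coe measurableSet_Ioo
  have hJr : ∀ r ∈ Ioo s t, Measurable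
      (fun p : Vec d × Vec d => bismut A Q f B φ r t (stateMap A Q f s x r p.1) p.2) :=
    fun r hr => by
      simpa only [Function.comp_def, id_eq] using
        hJ.comp (measurable_const (a := (⟨r, hr⟩ : Ioo s t)).prodMk measurable_id)
  have hmeasB : AEMeasurable (fun r => ENNReal.ofReal (√(t - r))⁻¹ *
      ∫⁻ z, ‖B r (stateMap A Q f s x r z)‖ₑ ∂(stdGaussian (Vec d)))
      (volume.restrict (Ioo s t)) := by
    -- Measurability in `r` is known only on `Ioo s t`, so it is checked on the subtype and
    -- transported by the embedding.
    rw [← map_comap_subtype_coe measurableSet_Ioo, hme.aemeasurable_map_iff]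
    refine Measurable.aemeasurable ?_
    have h1 : Measurable fun p : Ioo s t × Vec d => ‖B p.1 (stateMap A Q f s x p.1 p.2)‖ₑ := by
      simpa only [Function.comp_def] using (hB.comp (measurable_fst.prodMk
        (continuous_stateMap_uncurry (A := A) (x := x) hQ.posSemidef hst hf).measurable)).enorm
    have h2 : Measurable fun r : Ioo s t => ENNReal.ofReal (√(t - r))⁻¹ := by fun_prop
    simpa only [Function.comp_def, Pi.mul_def] using
      h2.mul (h1.lintegral_prod_right' (ν := stdGaussian (Vec d)))
  have hmeasJ : AEStronglyMeasurable
      (fun r => ∫ p, bismut A Q f B φ r t (stateMap A Q f s x r p.1) p.2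
        ∂((stdGaussian (Vec d)).prod (stdGaussian (Vec d)))) (volume.restrict (Ioo s t)) := by
    rw [← map_comap_subtype_coe measurableSet_Ioo, hme.aestronglyMeasurable_map_iff]
    have h := (hJ.stronglyMeasurable.integral_prod_right'
      (ν := (stdGaussian (Vec d)).prod (stdGaussian (Vec d)))).aestronglyMeasurable
        (μ := Measure.comap ((↑) : Ioo s t → ℝ) volume)
    simpa only [Function.comp_def] using h
  constructor
  -- A finite time integral forces finite space moments for almost every `r`, which is why
  -- integrability holds only almost everywhere.
  · filter_upwards [ae_lt_top' hmeasB hint.ne, ae_restrict_mem measurableSet_Ioo] with r hr hr'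
    refine ⟨(hJr r hr').aestronglyMeasurable, ?_⟩
    exact (hK r hr' (hBr r hr')).trans_lt (ENNReal.mul_lt_top ENNReal.ofReal_lt_top hr)
  · refine ⟨hmeasJ, ?_⟩
    refine lt_of_le_of_lt ?_ (ENNReal.mul_lt_top (ENNReal.ofReal_lt_top (r := K)) hint)
    rw [← lintegral_const_mul' _ _ ENNReal.ofReal_ne_top]
    refine setLIntegral_mono' measurableSet_Ioo fun r hr => ?_
    exact (enorm_integral_le_lintegral_enorm _).trans (hK r hr (hBr r hr))

end FirstIncrementFormula

end ShiftedKolmogorov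

end

/-! ### Assembly: Fubini in space, then equality of the time integrands almost everywhere. -/

theorem mainTheorem4 {d : ℕ} {Ω : Type*} [MeasurableSpace Ω] (P : Measure Ω)
    [IsProbabilityMeasure P]
    (A Q : ShiftedKolmogorov.Mat d) (hA : (-A).PosDef) (hQ : Q.PosDef)
    (W : ℝ≥0 → Ω → ShiftedKolmogorov.Vec d) (hW : ShiftedKolmogorov.IsBrownianMotion W P)
    (T : ℝ) (f : ℝ → ShiftedKolmogorov.Vec d) (hf : ContinuousOn f (Icc 0 T))
    -- the drift, and the drift `B` after subtraction of the shift
    (B₀ B : ℝ → ShiftedKolmogorov.Vec d → ShiftedKolmogorov.Vec d)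
    (hB₀ : Measurable (fun p : Icc (0 : ℝ) T × ShiftedKolmogorov.Vec d => B₀ p.1 p.2))
    (hB : ∀ r ∈ Icc 0 T, ∀ y, B r y = B₀ r y - f r)
    -- the family of shifted Gaussian processes `Z_{s,t}^x`
    (Z : ℝ → ShiftedKolmogorov.Vec d → ℝ → Ω → ShiftedKolmogorov.Vec d)
    (hZ : ∀ s ∈ Icc 0 T, ∀ x,
      ShiftedKolmogorov.IsLinearSDESolution P W A Q f T s x (Z s x))
    (φ : ShiftedKolmogorov.Vec d → ℝ) (hφ : Measurable φ) (hφb : ∃ C : ℝ, ∀ y, |φ y| ≤ C)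
    (s t : ℝ) (hs : 0 ≤ s) (hst : s < t) (htT : t ≤ T) (x : ShiftedKolmogorov.Vec d)
    -- finiteness of the expectations involved; automatic if `B` is bounded
    (hint : ∫⁻ r in Ioo s t, ENNReal.ofReal (√(t - r))⁻¹ *
      ∫⁻ ω, ‖B r (Z s x r ω)‖ₑ ∂P < ⊤) :
    -- the derivative in the iteration exists
    (∀ r ∈ Ico s t, Differentiable ℝ (ShiftedKolmogorov.incr P Z B φ 0 r t)) ∧
    -- the integrals that define `v^1` exist
    (∀ᵐ r ∂(volume.restrict (Ioo s t)), Integrable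
      (fun ω => ⟪B r (Z s x r ω), ∇ (ShiftedKolmogorov.incr P Z B φ 0 r t) (Z s x r ω)⟫) P) ∧
    IntervalIntegrable (fun r => ShiftedKolmogorov.evol P Z s r
      (fun y => ⟪B r y, ∇ (ShiftedKolmogorov.incr P Z B φ 0 r t) y⟫) x) volume s t ∧
    -- the integrals in the formula exist
    (∀ᵐ r ∂(volume.restrict (Ioo s t)), Integrable
      (ShiftedKolmogorov.weighted A Q f Z B φ s t x r) P) ∧
    IntervalIntegrable
      (fun r => ∫ ω, ShiftedKolmogorov.weighted A Q f Z B φ s t x r ω ∂P) volume s t ∧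
    -- the formula
    ShiftedKolmogorov.incr P Z B φ 1 s t x =
      ∫ r in s..t, ∫ ω, ShiftedKolmogorov.weighted A Q f Z B φ s t x r ω ∂P := by
  obtain ⟨C, hC⟩ := hφb
  have hsT : s ∈ Icc 0 T := ⟨hs, hst.le.trans htT⟩
  have hY := hZ s hsT x
  have hfsT : ContinuousOn f (Icc s T) := hf.mono (Icc_subset_Icc_left hs)
  have hfst : ContinuousOn f (Icc s t) := hfsT.mono (Icc_subset_Icc_right htT)
  have hmem : ∀ r ∈ Ioo s t, r ∈ Icc 0 T := fun r hr =>
    ⟨hs.trans hr.1.le, hr.2.le.trans htT⟩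
  have hBm : Measurable (fun p : Ioo s t × ShiftedKolmogorov.Vec d => B p.1 p.2) := by
    have h1 : Measurable (fun p : Ioo s t × ShiftedKolmogorov.Vec d => B₀ p.1 p.2) :=
      hB₀.comp (((measurable_subtype_coe.comp measurable_fst).subtype_mk
        (h := fun p : Ioo s t × ShiftedKolmogorov.Vec d => hmem _ p.1.2)).prodMk measurable_snd)
    have h2 : Continuous (fun p : Ioo s t × ShiftedKolmogorov.Vec d => f p.1) :=
      hfst.comp_continuous (by fun_prop) fun p => Ioo_subset_Icc_self p.1.2
    simpa only [hB _ (hmem _ (Subtype.prop _)), Pi.sub_def] using h1.sub h2.measurable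
  have hBr : ∀ r ∈ Ioo s t, Measurable (B r) := fun r hr =>
    hBm.comp (measurable_const (a := (⟨r, hr⟩ : Ioo s t)).prodMk measurable_id)
  -- The moment condition depends only on the law of `Z_{s,r}`, so it is restated for the standard
  -- Gaussian measure.
  rw [setLIntegral_congr_fun measurableSet_Ioo fun r hr => by
    rw [ShiftedKolmogorov.lintegral_enorm_drift hQ.posSemidef hW hfsT hY (hBr r hr) hs hr.1.le
      (hr.2.le.trans htT)]] at hint
  obtain ⟨hJ, hG⟩ := ShiftedKolmogorov.integrable_bismut (A := A) hQ hst.le hs hfst hφ hC hBm hint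
  have hgrad : ∀ r ∈ Ioo s t, ∀ y,
      ⟪B r y, ∇ (ShiftedKolmogorov.incr P Z B φ 0 r t) y⟫ =
        ∫ z, ShiftedKolmogorov.bismut A Q f B φ r t y z
          ∂(stdGaussian (ShiftedKolmogorov.Vec d)) := fun r hr y =>
    ShiftedKolmogorov.inner_gradient_incr_zero hQ hW hf hZ hφ hC (hs.trans hr.1.le) hr.2 htT y
  have hev : ∀ᵐ r ∂(volume.restrict (Ioo s t)),
      ShiftedKolmogorov.evol P Z s r
        (fun y => ⟪B r y, ∇ (ShiftedKolmogorov.incr P Z B φ 0 r t) y⟫) x =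
      ∫ ω, ShiftedKolmogorov.weighted A Q f Z B φ s t x r ω ∂P := by
    filter_upwards [hJ, ae_restrict_mem measurableSet_Ioo] with r hi hr
    rw [ShiftedKolmogorov.integral_weighted hQ hW hfsT hY hφ (hBr r hr) hs hr.1.le hr.2 htT,
      ← ShiftedKolmogorov.integral_integral_bismut hQ.posSemidef hW hfsT hY hφ (hBr r hr) hs hr.1.le
        (hr.2.le.trans htT) hi]
    simp only [ShiftedKolmogorov.evol, hgrad r hr]
  have hwint : IntegrableOn (fun r => ∫ ω, ShiftedKolmogorov.weighted A Q f Z B φ s t x r ω ∂P)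
      (Ioo s t) := by
    refine hG.congr_fun (fun r hr => ?_) measurableSet_Ioo
    exact (ShiftedKolmogorov.integral_weighted hQ hW hfsT hY hφ (hBr r hr) hs hr.1.le hr.2
      htT).symm
  refine ⟨fun r hr => ?_, ?_, ?_, ?_, ?_, ?_⟩
  · exact ShiftedKolmogorov.differentiable_incr_zero hQ hW hf hZ hφ hC (hs.trans hr.1) hr.2 htT
  · filter_upwards [hJ, ae_restrict_mem measurableSet_Ioo] with r hi hr
    simp only [hgrad r hr]
    exact ShiftedKolmogorov.integrable_integral_bismut hQ.posSemidef hW hfsT hY hφ (hBr r hr) hs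
      hr.1.le (hr.2.le.trans htT) hi
  · rw [intervalIntegrable_iff_integrableOn_Ioo_of_le hst.le]
    exact hwint.congr (hev.mono fun r h => h.symm)
  · filter_upwards [hJ, ae_restrict_mem measurableSet_Ioo] with r hi hr
    exact (ShiftedKolmogorov.integrable_weighted_iff hQ hW hfsT hY hφ (hBr r hr) hs hr.1.le hr.2
      htT).2 hi
  · rwa [intervalIntegrable_iff_integrableOn_Ioo_of_le hst.le]
  -- In `u^1 - u^0` the term `S_{s,t} φ` cancels; `iter` and `incr` agree at index `0` by
  -- definition.
  · have h1 : ShiftedKolmogorov.incr P Z B φ 1 s t x = ∫ r in s..t, ShiftedKolmogorov.evol P Z s r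
        (fun y => ⟪B r y, ∇ (ShiftedKolmogorov.incr P Z B φ 0 r t) y⟫) x :=
      add_sub_cancel_left _ _
    rw [h1, intervalIntegral.integral_of_le hst.le, intervalIntegral.integral_of_le hst.le,
      integral_Ioc_eq_integral_Ioo, integral_Ioc_eq_integral_Ioo]
    exact integral_congr_ae hev
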